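/- Let $r\ge 1$, let $\mathbf d=(d_1,\dots,d_r)$ be a tuple of integers $d_k\ge 1$, and put $|\mathbf d|=\sum_{k=1}^r d_k$ and $\mathbf d^{\mathbf d}=\prod_{k=1}^r d_k^{d_k}$. Let $n$ be an integer with $n>|\mathbf d|$. Consider the formal power series in $q$ $$\varphi(z,q)=\sum_{\beta\ge 0}q^\beta\,\frac{\prod_{k=1}^r\prod_{i=1}^{d_k\beta}(d_k+iz)}{\prod_{j=1}^{\beta}\big((1+jz)^n-1\big)},$$ whose coefficients are rational functions of $z$, expanded as Laurent series at $z=0$. Define (with residues, derivatives and values at $z=0$ taken coefficientwise in $q$) $$\mu(q)=\operatorname{Res}_{z=0}\ln\varphi(z,q),\qquad L(q)=1+q\,\mu'(q),\qquad Q(z,q)=e^{-\mu(q)/z}\varphi(z,q),\qquad \Phi_i(q)=\frac{\partial^i}{\partial z^i}Q(z,q)\Big|_{z=0}\quad (i=0,1).$$ Then $L(q)$ has constant term $1$; put $S(q)=1+\mathbf d^{\mathbf d}\big(1-\tfrac{|\mathbf d|}{n}\big)\,q\,L(q)^{|\mathbf d|}$. Rational powers of power series with constant term $1$ are given by the binomial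 series, i.e. they are the powers with constant term $1$. Then $Q(z,q)$ is holomorphic at $z=0$, i.e. every coefficient of $Q$ as a power series in $q$ has no pole at $z=0$ (so that $\Phi_0$ and $\Phi_1$ are well defined), and the following identities hold in $\mathbb C[[q]]$, where $L=L(q)$ and $S=S(q)$. (i) $\displaystyle \Phi_0(q)=L^{\frac{r+1}{2}}\,S^{-\frac12}.$ (ii) $$\begin{aligned} \Phi_1(q)={}&\frac{3r^2-2|\mathbf d|\sum_{k=1}^r\frac1{d_k}-1}{24|\mathbf d|}\,L^{\frac{r-1}{2}}\,(L-1)\,S^{-\frac12} +\frac{L^{\frac{r-1}{2}}\,S^{-\frac72}}{24|\mathbf d|n^3}\Big(|\mathbf d|^3\big(|\mathbf d|n-|\mathbf d|-3r^2+1\big)L\\ &+|\mathbf d|^2n\big(2|\mathbf d|^2-6|\mathbf d|n-6|\mathbf d|r+3n^2+6nr+n+3r^2-1\big)L^{n}\\ &+3|\mathbf d|^2(n-|\mathbf d|)\big(|\mathbf d|n-|\mathbf d|-3r^2+1\big)L^{n+1}\\ &+|\mathbf d|n(n-|\mathbf d|)\big(4|\mathbf d|^2-5|\mathbf d|n-12|\mathbf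 d|r-2n^2+6nr+n+6r^2-2\big)L^{2n}\\ &+3|\mathbf d|(n-|\mathbf d|)^2\big(|\mathbf d|n-|\mathbf d|-3r^2+1\big)L^{2n+1}\\ &+n(n-|\mathbf d|)^2\big(2|\mathbf d|^2+|\mathbf d|n-6|\mathbf d|r+3r^2-1\big)L^{3n}\\ &+(n-|\mathbf d|)^3\big(|\mathbf d|n-|\mathbf d|-3r^2+1\big)L^{3n+1}\Big). \end{aligned}$$ -/

import Mathlib

noncomputable section

namespace FanoHypergeometric

/-- `|d| = d_1 + ... + d_r`. -/
def totalDegree {r : ℕ} (d : Fin r → ℕ) : ℕ := ∑ k, d k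

/-- `d^d = ∏ d_k ^ d_k`. -/
def selfPower {r : ℕ} (d : Fin r → ℕ) : ℕ := ∏ k, d k ^ d k

/-- The variable `z`, as a formal Laurent series. -/
def z : LaurentSeries ℂ := HahnSeries.single (1 : ℤ) (1 : ℂ)

/-- The hypergeometric series
`φ(z, q) = ∑_β q^β (∏_k ∏_{i=1}^{d_k β} (d_k + i z)) / ∏_{j=1}^β ((1 + j z)^n - 1)`,
a power series in `q` whose coefficients are rational functions of `z`,
each expanded as a Laurent series at `z = 0`. -/
def phi (n : ℕ) {r : ℕ} (d : Fin r → ℕ) : PowerSeries (LaurentSeries ℂ) :=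
  PowerSeries.mk fun β : ℕ =>
    (∏ k : Fin r, ∏ i ∈ Finset.Icc 1 (d k * β), ((d k : LaurentSeries ℂ) + (i : LaurentSeries ℂ) * z)) /
      ∏ j ∈ Finset.Icc 1 β, ((1 + (j : LaurentSeries ℂ) * z) ^ n - 1)

/-- `μ(q) = Res_{z = 0} (ln φ(z, q))`, the residue being taken coefficientwise in `q`. -/
def mu (n : ℕ) {r : ℕ} (d : Fin r → ℕ) : PowerSeries ℂ :=
  PowerSeries.mk fun β : ℕ => (PowerSeries.coeff β (PowerSeries.logOf (phi n d))).coeff (-1)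

/-- `L(q) = 1 + q μ'(q)`. -/
def L (n : ℕ) {r : ℕ} (d : Fin r → ℕ) : PowerSeries ℂ :=
  1 + PowerSeries.X * PowerSeries.derivative ℂ (mu n d)

/-- `Q(z, q) = e^{-μ(q)/z} φ(z, q)`. -/
def Q (n : ℕ) {r : ℕ} (d : Fin r → ℕ) : PowerSeries (LaurentSeries ℂ) :=
  (PowerSeries.exp (LaurentSeries ℂ)).subst
      (-(PowerSeries.C z⁻¹ * PowerSeries.map HahnSeries.C (mu n d)) :
        PowerSeries (LaurentSeries ℂ)) *
    phi n d

/-- A power series in `q` over the Laurent series in `z` is holomorphic at `z = 0`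
if no coefficient has a pole there. -/
def HolomorphicAtZero (F : PowerSeries (LaurentSeries ℂ)) : Prop :=
  ∀ (β : ℕ) (m : ℤ), m < 0 → (PowerSeries.coeff β F).coeff m = 0

/-- `Φ_i(q) = (∂/∂z)^i Q(z, q) |_{z = 0}`. The value at `z = 0` of a Laurent series without pole
is its coefficient of `z ^ 0`. -/
def Phi (n : ℕ) {r : ℕ} (d : Fin r → ℕ) (i : ℕ) : PowerSeries ℂ :=
  PowerSeries.mk fun β : ℕ =>
    ((LaurentSeries.derivative ℂ)^[i] (PowerSeries.coeff β (Q n d))).coeff 0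

/-- The power `f ^ a = ∑_k (a choose k) (f - 1) ^ k` with rational exponent,
for a power series `f` with constant term `1`. -/
def ratPow (f : PowerSeries ℂ) (a : ℚ) : PowerSeries ℂ :=
  (PowerSeries.binomialSeries ℂ a).subst (f - 1)

/-- `S(q) = 1 + d^d (1 - |d|/n) q L(q)^{|d|}`. -/
def S (n : ℕ) {r : ℕ} (d : Fin r → ℕ) : PowerSeries ℂ :=
  1 + ((selfPower d : ℂ) * (1 - (totalDegree d : ℂ) / (n : ℂ))) •
    (PowerSeries.X * L n d ^ totalDegree d)

/-- The polynomial in `L` in the formula for `Φ_1`; here `t` stands for `|d|`. -/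
def phiOnePoly (n r t : ℕ) (L : PowerSeries ℂ) : PowerSeries ℂ :=
  ((t : ℂ) ^ 3 * (t * n - t - 3 * r ^ 2 + 1)) • L
  + ((t : ℂ) ^ 2 * n *
      (2 * t ^ 2 - 6 * t * n - 6 * t * r + 3 * n ^ 2 + 6 * n * r + n + 3 * r ^ 2 - 1)) • L ^ n
  + (3 * (t : ℂ) ^ 2 * (n - t) * (t * n - t - 3 * r ^ 2 + 1)) • L ^ (n + 1)
  + ((t : ℂ) * n * (n - t) *
      (4 * t ^ 2 - 5 * t * n - 12 * t * r - 2 * n ^ 2 + 6 * n * r + n + 6 * r ^ 2 - 2)) •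
        L ^ (2 * n)
  + (3 * (t : ℂ) * (n - t) ^ 2 * (t * n - t - 3 * r ^ 2 + 1)) • L ^ (2 * n + 1)
  + ((n : ℂ) * (n - t) ^ 2 * (2 * t ^ 2 + t * n - 6 * t * r + 3 * r ^ 2 - 1)) • L ^ (3 * n)
  + (((n : ℂ) - t) ^ 3 * (t * n - t - 3 * r ^ 2 + 1)) • L ^ (3 * n + 1)

end FanoHypergeometric

end

/-!
Write `D = q d/dq`, `t = |d|`, `κ = d^d`. Comparing consecutive coefficients, `φ` is a solution of
`((1 + z D) ^ n - 1) φ = κ q ∏_c (1 + z D + c z) φ`, the product running over the `t` constants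
`c = i / d_k` with `1 ≤ i ≤ d_k` (`shiftProd_phi`). The theorem is the WKB expansion of this
equation at `z = 0`.

Let `ℓ` be the series with constant term `1` and `ℓ ^ n - 1 = κ q ℓ ^ t`, and let `m` be the series
without constant term for which `ℓ = 1 + D m`. Conjugation by `e^{m/z}` replaces `1 + z D` by
`ℓ + z D`, so that `e^{-m/z} φ` is annihilated by `(ℓ + z D) ^ n - 1 - κ q ∏_c (ℓ + z D + c z)`.
By the choice of `ℓ` this operator is divisible by `z`. After the division, it multiplies the
lowest term `q ^ β` of a series by `((1 + β z) ^ n - 1) / z`, which is a unit of `ℂ⟦z⟧` for `β ≥ 1`;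
hence all the coefficients of `e^{-m/z} φ` lie in `ℂ⟦z⟧` (`exists_map_eq_of_shiftRem_eq`).
Then `ln φ` is `m / z` up to a series without pole, which shows that `m = μ`, `ℓ = L` and `e^{-m/z} φ = Q`
(`exists_regular_factor`).

The coefficients of `z ^ 0` and `z ^ 1` of the divided equation are linear differential equations of
first order for `Φ₀` and `Φ₁` (`zCoeff_zero_shiftRem`, `zCoeff_one_shiftRem`, `transport_zCoeff`).
Such an equation determines its solution from the constant term (`eq_of_transport_eq`), so it
remains to substitute the closed formulas. With `N = L ^ n` one has `n S = (n - t) N + t` and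
`D L = L (N - 1) / (n S)`, and the substitution becomes an identity of rational functions
(`transport_leading`, `transport_subleading`). It is linear in `1 / L` because
`Φ₁ / Φ₀ = (n - 1 - 2 ∑ 1 / d_k) / 24 + h / L` with `h` a rational function of `N`.
-/

noncomputable section

namespace FanoHypergeometric

open PowerSeries

/-! ### The Euler derivation and linear equations of first order -/

section Euler

variable {A B : Type*} [CommRing A] [CommRing B]

/-- The Euler derivation `q d/dq` on power series in `q`. -/
def euler (A : Type*) [CommRing A] : Derivation A (PowerSeries A) (PowerSeries A) :=
  (X : PowerSeries A) • derivative A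

theorem euler_apply (f : PowerSeries A) : euler A f = X * derivative A f := rfl

@[simp]
theorem coeff_euler (f : PowerSeries A) (β : ℕ) : coeff β (euler A f) = β * coeff β f := by
  rw [euler_apply]
  cases β with
  | zero => simp
  | succ β => rw [coeff_succ_X_mul, coeff_derivative]; push_cast; ring

@[simp]
theorem constantCoeff_euler (f : PowerSeries A) : constantCoeff (euler A f) = 0 := by
  rw [← coeff_zero_eq_constantCoeff_apply, coeff_euler]; simp

theorem euler_mul (f g : PowerSeries A) : euler A (f * g) = f * euler A g + g * euler A f := by
  simp [Derivation.leibniz]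

theorem euler_C_mul (a : A) (f : PowerSeries A) : euler A (C a * f) = C a * euler A f := by
  ext β; rw [coeff_euler, coeff_C_mul, coeff_C_mul, coeff_euler]; ring

theorem euler_pow (f : PowerSeries A) (m : ℕ) :
    euler A (f ^ m) = m * f ^ (m - 1) * euler A f := by
  rw [euler_apply, derivative_pow, euler_apply]; ring

theorem euler_map (ι : A →+* B) (f : PowerSeries A) : euler B (map ι f) = map ι (euler A f) := by
  ext β; simp

theorem euler_X_pow_mul (β : ℕ) (f : PowerSeries A) :
    euler A (X ^ β * f) = X ^ β * (euler A f + C (β : A) * f) := by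
  have h : euler A (X ^ β : PowerSeries A) = C (β : A) * X ^ β := by
    ext m
    rw [coeff_euler, coeff_C_mul, coeff_X_pow]
    split_ifs with h <;> simp [h]
  rw [euler_mul, h]; ring

theorem euler_subst (f : PowerSeries A) {g : PowerSeries A} (hg : constantCoeff g = 0) :
    euler A (f.subst g) = (derivative A f).subst g * euler A g := by
  rw [euler_apply, derivative_subst (HasSubst.of_constantCoeff_zero' hg), euler_apply]; ring

/-- A homogeneous linear equation `q Y' = b Y` with `b(0) = 0` has no solution with `Y(0) = 0` other
than `Y = 0`. -/
theorem eq_zero_of_euler_eq_mul [IsDomain A] [CharZero A] {b Y : PowerSeries A}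
    (hb : constantCoeff b = 0) (hY : constantCoeff Y = 0) (h : euler A Y = b * Y) : Y = 0 := by
  ext β
  induction β using Nat.strong_induction_on with
  | _ β ih =>
    rcases Nat.eq_zero_or_pos β with rfl | hβ
    · simpa using hY
    · have h1 := congrArg (coeff β) h
      rw [coeff_euler, coeff_mul, Finset.sum_eq_zero] at h1
      · have : (β : A) ≠ 0 := by exact_mod_cast hβ.ne'
        simpa [this] using h1
      · rintro ⟨i, j⟩ hij
        rw [Finset.HasAntidiagonal.mem_antidiagonal] at hij
        rcases Nat.eq_zero_or_pos i with rfl | hi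
        · simp [hb]
        · simp [ih j (by simp at hij; omega)]

theorem eq_of_euler_eq_mul [IsDomain A] [CharZero A] {b Y Z : PowerSeries A}
    (hb : constantCoeff b = 0) (hYZ : constantCoeff Y = constantCoeff Z)
    (hY : euler A Y = b * Y) (hZ : euler A Z = b * Z) : Y = Z := by
  refine sub_eq_zero.mp (eq_zero_of_euler_eq_mul hb ?_ ?_)
  · rw [map_sub, hYZ, sub_self]
  · rw [map_sub, hY, hZ, mul_sub]

theorem euler_exp_subst [Algebra ℚ A] {g : PowerSeries A} (hg : constantCoeff g = 0) :
    euler A ((exp A).subst g) = euler A g * (exp A).subst g := by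
  rw [euler_subst _ hg, derivative_exp, mul_comm]

theorem constantCoeff_subst_of_zero {f g : PowerSeries A} (hg : constantCoeff g = 0) :
    constantCoeff (f.subst g : PowerSeries A) = constantCoeff f := by
  have h : f = C (constantCoeff f) + (f - C (constantCoeff f)) := by ring
  have hs := HasSubst.of_constantCoeff_zero' hg
  have h0 : constantCoeff ((f - C (constantCoeff f)).subst g : PowerSeries A) = 0 :=
    constantCoeff_subst_eq_zero hg _ (by simp)
  have h1 : ((C (constantCoeff f) : PowerSeries A).subst g : PowerSeries A) =
    C (constantCoeff f) := subst_C _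
  conv_lhs => rw [h]
  rw [subst_add hs, map_add, h0, add_zero, h1]
  simp

/-- `f · q (ln f)' = q f'`. -/
theorem mul_euler_logOf [Algebra ℚ A] {f : PowerSeries A} (hf : constantCoeff f = 1) :
    f * euler A (logOf f) = euler A f := by
  have hg : constantCoeff (f - 1) = 0 := by simp [hf]
  have hs := HasSubst.of_constantCoeff_zero' hg
  have h : (1 + X) * derivative A (log A) = 1 := by
    rw [deriv_log]
    ext m
    rw [add_mul, one_mul, map_add]
    cases m with
    | zero => simp
    | succ m =>
      rw [coeff_succ_X_mul, coeff_mk, coeff_mk, ← map_add, coeff_one]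
      simp [pow_succ]
  have h2 := congrArg (fun p : PowerSeries A => (p.subst (f - 1) : PowerSeries A)) h
  simp only [subst_mul hs, subst_add hs, subst_X hs] at h2
  have h1 : ((1 : PowerSeries A).subst (f - 1) : PowerSeries A) = 1 := by
    rw [← coe_substAlgHom hs, map_one]
  rw [h1] at h2
  rw [logOf_eq, euler_subst _ hg, map_sub, Derivation.map_one_eq_zero]
  linear_combination (euler A f) * h2

end Euler

/-! ### Rational powers of power series with constant term one -/

section RatPow

/-- The differential equation `(1 + X) B' = a B` of the binomial series. -/
theorem one_add_X_mul_derivative_binomialSeries (a : ℚ) :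
    (1 + X) * derivative ℂ (PowerSeries.binomialSeries ℂ a) =
      (a : ℂ) • PowerSeries.binomialSeries ℂ a := by
  have key (m : ℕ) : ((m : ℚ) + 1) * Ring.choose a (m + 1) = (a - m) * Ring.choose a m := by
    have h1 := Ring.descPochhammer_eq_factorial_smul_choose a (m + 1)
    have h2 := Ring.descPochhammer_eq_factorial_smul_choose a m
    rw [descPochhammer_succ_right, Polynomial.smeval_mul, h2] at h1
    have h3 : (Polynomial.X - (m : Polynomial ℤ)).smeval a = a - m := by
      rw [Polynomial.smeval_sub, Polynomial.smeval_X, Polynomial.smeval_natCast]; simp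
    rw [h3, Nat.factorial_succ] at h1
    have h4 : (m.factorial : ℚ) ≠ 0 := by exact_mod_cast m.factorial_ne_zero
    simp only [nsmul_eq_mul] at h1
    push_cast at h1
    apply mul_left_cancel₀ h4
    linear_combination -h1
  have keyC (m : ℕ) : ((m : ℂ) + 1) * (Ring.choose a (m + 1) : ℚ) =
      ((a : ℂ) - m) * (Ring.choose a m : ℚ) := by exact_mod_cast congrArg (Rat.cast : ℚ → ℂ) (key m)
  ext m
  rw [add_mul, one_mul, map_add, coeff_smul]
  cases m with
  | zero =>
    have := keyC 0
    simp [coeff_derivative, binomialSeries_coeff, Rat.smul_def] at this ⊢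
  | succ m =>
    rw [coeff_succ_X_mul, coeff_derivative, coeff_derivative]
    simp only [binomialSeries_coeff, Rat.smul_def, smul_eq_mul, mul_one]
    have := keyC (m + 1)
    push_cast at this ⊢
    linear_combination this

variable {f : PowerSeries ℂ}

theorem constantCoeff_ratPow (hf : constantCoeff f = 1) (a : ℚ) :
    constantCoeff (ratPow f a) = 1 := by
  rw [ratPow, constantCoeff_subst_of_zero (by simp [hf]), binomialSeries_constantCoeff]

/-- `f · q (f ^ a)' = a · q f' · f ^ a`, which together with the constant term determines
`f ^ a`. -/
theorem mul_euler_ratPow (hf : constantCoeff f = 1) (a : ℚ) :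
    f * euler ℂ (ratPow f a) = C (a : ℂ) * euler ℂ f * ratPow f a := by
  have hg : constantCoeff (f - 1) = 0 := by simp [hf]
  have hs := HasSubst.of_constantCoeff_zero' hg
  have h2 := congrArg (fun p : PowerSeries ℂ => (p.subst (f - 1) : PowerSeries ℂ))
    (one_add_X_mul_derivative_binomialSeries a)
  simp only [subst_mul hs, subst_add hs, subst_X hs, subst_smul hs] at h2
  have h1 : ((1 : PowerSeries ℂ).subst (f - 1) : PowerSeries ℂ) = 1 := by
    rw [← coe_substAlgHom hs, map_one]
  rw [h1, smul_eq_C_mul] at h2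
  rw [ratPow, euler_subst _ hg, map_sub, Derivation.map_one_eq_zero]
  linear_combination (euler ℂ f) * h2

/-- Lowering the exponent of a rational power by a natural number `m`. -/
theorem ratPow_mul_pow (hf : constantCoeff f = 1) (a b : ℚ) (m : ℕ) (hab : a + m = b) :
    ratPow f a * f ^ m = ratPow f b := by
  have hfu : f * f⁻¹ = 1 := PowerSeries.mul_inv_cancel _ (by simp [hf])
  have step (c : ℚ) (Y : PowerSeries ℂ) (h : f * euler ℂ Y = C (c : ℂ) * euler ℂ f * Y) :
      euler ℂ Y = (C (c : ℂ) * euler ℂ f * f⁻¹) * Y := by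
    linear_combination f⁻¹ * h - euler ℂ Y * hfu
  refine eq_of_euler_eq_mul (b := C (b : ℂ) * euler ℂ f * f⁻¹) (by simp) ?_ (step b _ ?_)
    (step b _ (mul_euler_ratPow hf b))
  · simp [constantCoeff_ratPow hf, hf]
  · have hp : f * euler ℂ (f ^ m) = C (m : ℂ) * euler ℂ f * f ^ m := by
      rw [euler_pow]
      cases m with
      | zero => simp
      | succ m => simp [pow_succ]; ring
    have hbc : C (b : ℂ) = C (a : ℂ) + C (m : ℂ) := by rw [← map_add, ← hab]; push_cast; rfl
    rw [euler_mul, hbc]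
    linear_combination ratPow f a * hp + f ^ m * mul_euler_ratPow hf a

end RatPow

/-! ### Products of the operators `ℓ + z q d/dq + c z` -/

section ShiftOperators

variable {A B : Type*} [CommRing A] [CommRing B]

/-- The operator `∏_c (ℓ + z q d/dq + c z)`, the product running over the list of constants `c`,
with the first entry acting last. -/
def shiftProd (z : A) (ℓ : PowerSeries A) : List A → PowerSeries A → PowerSeries A
  | [], f => f
  | c :: cs, f =>
    ℓ * shiftProd z ℓ cs f + C z * (euler A (shiftProd z ℓ cs f) + C c * shiftProd z ℓ cs f)

/-- The operator `z⁻¹ (∏_c (ℓ + z q d/dq + c z) - ∏_c ℓ)`, which makes sense over any ring of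
coefficients because the difference is divisible by `z`. -/
def shiftRem (z : A) (ℓ : PowerSeries A) : List A → PowerSeries A → PowerSeries A
  | [], _ => 0
  | c :: cs, f =>
    ℓ * shiftRem z ℓ cs f + (euler A (shiftProd z ℓ cs f) + C c * shiftProd z ℓ cs f)

variable (z : A) (ℓ : PowerSeries A)

theorem shiftProd_eq (cs : List A) (f : PowerSeries A) :
    shiftProd z ℓ cs f = ℓ ^ cs.length * f + C z * shiftRem z ℓ cs f := by
  induction cs with
  | nil => simp [shiftProd, shiftRem]
  | cons c cs ih =>
    rw [shiftProd, shiftRem, List.length_cons]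
    linear_combination ℓ * ih

theorem shiftProd_add (cs : List A) (f g : PowerSeries A) :
    shiftProd z ℓ cs (f + g) = shiftProd z ℓ cs f + shiftProd z ℓ cs g := by
  induction cs with
  | nil => rfl
  | cons c cs ih => simp only [shiftProd, ih, map_add]; ring

theorem shiftRem_add (cs : List A) (f g : PowerSeries A) :
    shiftRem z ℓ cs (f + g) = shiftRem z ℓ cs f + shiftRem z ℓ cs g := by
  induction cs with
  | nil => simp [shiftRem]
  | cons c cs ih => simp only [shiftRem, shiftProd_add, ih, map_add]; ring

theorem shiftProd_map (ι : A →+* B) (cs : List A) (f : PowerSeries A) :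
    shiftProd (ι z) (map ι ℓ) (cs.map ι) (map ι f) = map ι (shiftProd z ℓ cs f) := by
  induction cs with
  | nil => rfl
  | cons c cs ih => simp only [List.map_cons, shiftProd, ih, euler_map, map_add, map_mul, map_C]

theorem shiftRem_map (ι : A →+* B) (cs : List A) (f : PowerSeries A) :
    shiftRem (ι z) (map ι ℓ) (cs.map ι) (map ι f) = map ι (shiftRem z ℓ cs f) := by
  induction cs with
  | nil => simp [shiftRem]
  | cons c cs ih =>
    simp only [List.map_cons, shiftRem, shiftProd_map, ih, euler_map, map_add, map_mul, map_C]

/-- Conjugation by a solution `E` of `z q E' = ev E` replaces `ℓ` by `ℓ + ev`. -/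
theorem shiftProd_conj {E ev : PowerSeries A} (hE : C z * euler A E = ev * E) (cs : List A)
    (f : PowerSeries A) : shiftProd z ℓ cs (E * f) = E * shiftProd z (ℓ + ev) cs f := by
  induction cs with
  | nil => rfl
  | cons c cs ih =>
    simp only [shiftProd, ih, euler_mul]
    linear_combination shiftProd z (ℓ + ev) cs f * hE

/-- Conjugation by `q ^ β` adds `β` to every constant. -/
theorem shiftProd_X_pow_mul (β : ℕ) (cs : List A) (f : PowerSeries A) :
    shiftProd z ℓ cs (X ^ β * f) = X ^ β * shiftProd z ℓ (cs.map fun c => β + c) f := by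
  induction cs with
  | nil => rfl
  | cons c cs ih => simp only [List.map_cons, shiftProd, ih, euler_X_pow_mul, map_add]; ring

theorem shiftRem_X_pow_mul (β : ℕ) (cs : List A) (f : PowerSeries A) :
    shiftRem z ℓ cs (X ^ β * f) = X ^ β * shiftRem z ℓ (cs.map fun c => β + c) f := by
  induction cs with
  | nil => simp [shiftRem]
  | cons c cs ih =>
    simp only [List.map_cons, shiftRem, ih, shiftProd_X_pow_mul, euler_X_pow_mul, map_add]; ring

theorem coeff_shiftProd_one (cs : List A) (f : PowerSeries A) (β : ℕ) :
    coeff β (shiftProd z 1 cs f) = (cs.map fun c => 1 + z * (β + c)).prod * coeff β f := by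
  induction cs with
  | nil => simp [shiftProd]
  | cons c cs ih =>
    simp only [shiftProd, List.map_cons, List.prod_cons, map_add, one_mul, coeff_C_mul, coeff_euler,
      ih]
    ring

/-- The scalar by which the constant term of a series is multiplied under `shiftRem`, when
`ℓ` has constant term `1`: it is `z⁻¹ (∏_c (1 + c z) - 1)`. -/
def remSymbol (z : A) : List A → A
  | [] => 0
  | c :: cs => remSymbol z cs + c * (cs.map fun c => 1 + z * c).prod

theorem remSymbol_map (ι : A →+* B) (cs : List A) :
    remSymbol (ι z) (cs.map ι) = ι (remSymbol z cs) := by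
  induction cs with
  | nil => simp [remSymbol]
  | cons c cs ih =>
    simp [remSymbol, ih, Function.comp_def, map_list_prod]

variable {ℓ}

theorem constantCoeff_shiftProd (hℓ : constantCoeff ℓ = 1) (cs : List A) (f : PowerSeries A) :
    constantCoeff (shiftProd z ℓ cs f) =
      (cs.map fun c => 1 + z * c).prod * constantCoeff f := by
  induction cs with
  | nil => simp [shiftProd]
  | cons c cs ih => simp [shiftProd, ih, hℓ]; ring

theorem constantCoeff_shiftRem (hℓ : constantCoeff ℓ = 1) (cs : List A) (f : PowerSeries A) :
    constantCoeff (shiftRem z ℓ cs f) = remSymbol z cs * constantCoeff f := by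
  induction cs with
  | nil => simp [shiftRem, remSymbol]
  | cons c cs ih => simp [shiftRem, remSymbol, ih, hℓ, constantCoeff_shiftProd z hℓ]; ring

/-- At `z = 0` the symbol `z⁻¹ (∏_c (1 + c z) - 1)` is the sum of the constants. -/
theorem constantCoeff_remSymbol_X {k : Type*} [CommRing k] (cs : List (PowerSeries k)) :
    constantCoeff (remSymbol X cs) = (cs.map constantCoeff).sum := by
  have h (cs : List (PowerSeries k)) :
      constantCoeff (cs.map fun c => 1 + X * c).prod = 1 := by
    induction cs with
    | nil => simp
    | cons c cs ih => simp [ih]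
  induction cs with
  | nil => simp [remSymbol]
  | cons c cs ih => simp [remSymbol, ih, h, add_comm]

end ShiftOperators

/-! ### Holomorphy of solutions at `z = 0` -/

section Integrality

variable {k K : Type*} [Field k] [Field K]

/-- Let `ι` be a homomorphism from `k⟦z⟧` to a field `K`. A solution over `K` of
`shiftRem (m zeros) f = a q · shiftRem cs f` with constant term `1` is defined over `k⟦z⟧`:
the equation at `q ^ β` expresses the coefficient of `q ^ β`, multiplied by a unit with constant
term `m β`, through the coefficients of smaller index. -/
theorem exists_map_eq_of_shiftRem_eq [CharZero k] (ι : PowerSeries k →+* K) {m : ℕ}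
    (hm : m ≠ 0) (ℓ a : PowerSeries (PowerSeries k)) (hℓ : constantCoeff ℓ = 1)
    (cs : List (PowerSeries k)) (f : PowerSeries K) (hf : constantCoeff f = 1)
    (h : shiftRem (ι X) (map ι ℓ) (List.replicate m 0) f =
      map ι a * X * shiftRem (ι X) (map ι ℓ) (cs.map ι) f) :
    ∃ F : PowerSeries (PowerSeries k), map ι F = f := by
  suffices H : ∀ β, ∃ y, ι y = coeff β f by
    choose y hy using H
    exact ⟨mk y, by ext β; simp [hy]⟩
  intro β
  induction β using Nat.strong_induction_on with
  | _ β ih =>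
    rcases Nat.eq_zero_or_pos β with rfl | hβ
    · exact ⟨1, by simp [hf]⟩
    choose y hy using ih
    set g : PowerSeries (PowerSeries k) := mk fun γ => if hγ : γ < β then y γ hγ else 0 with hg
    -- split `f` as `g + q ^ β u`, with `g` already known to be defined over `k⟦z⟧`
    obtain ⟨u, hu⟩ : (X : PowerSeries K) ^ β ∣ f - map ι g := by
      rw [X_pow_dvd_iff]
      intro γ hγ
      simp [hg, hγ, hy]
    have hfu : f = map ι g + X ^ β * u := by rw [← hu]; ring
    have hgβ : coeff β g = 0 := by simp [hg]
    have hcu : coeff β f = constantCoeff u := by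
      rw [hfu, map_add, coeff_map, hgβ, map_zero, zero_add, ← coeff_zero_eq_constantCoeff_apply]
      simpa using coeff_X_pow_mul u β 0
    have hz : List.replicate m (0 : K) = (List.replicate m 0).map ι := by simp
    have hℓK : constantCoeff (map ι ℓ) = 1 := by
      rw [← coeff_zero_eq_constantCoeff_apply, coeff_map, coeff_zero_eq_constantCoeff_apply, hℓ,
        map_one]
    rw [hz, hfu, shiftRem_add, shiftRem_add, shiftRem_map, shiftRem_map, shiftRem_X_pow_mul,
      shiftRem_X_pow_mul] at h
    set rem := shiftRem X ℓ (List.replicate m 0) g - a * X * shiftRem X ℓ cs g with hrem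
    have h1 : X ^ β * shiftRem (ι X) (map ι ℓ) (List.map (fun c => β + c)
          ((List.replicate m 0).map ι)) u = X ^ β * (X * (map ι a * shiftRem (ι X) (map ι ℓ)
          (List.map (fun c => β + c) (cs.map ι)) u)) - map ι rem := by
      simp only [hrem, map_sub, map_mul, map_X]
      linear_combination h
    -- compare the coefficients of `q ^ β`; the factor `q` removes `u` from the right-hand side
    have h2 := congrArg (coeff (0 + β)) h1
    rw [map_sub, coeff_X_pow_mul, coeff_X_pow_mul, coeff_zero_eq_constantCoeff_apply,
      coeff_zero_eq_constantCoeff_apply, constantCoeff_shiftRem _ hℓK] at h2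
    have h3 : List.map (fun c : K => β + c) ((List.replicate m 0).map ι) =
        (List.replicate m (β : PowerSeries k)).map ι := by simp
    rw [h3, remSymbol_map] at h2
    have h4 : IsUnit (remSymbol (X : PowerSeries k) (List.replicate m (β : PowerSeries k))) := by
      rw [isUnit_iff_constantCoeff, constantCoeff_remSymbol_X]
      simp [hm, hβ.ne']
    obtain ⟨v, hv⟩ := h4.exists_left_inv
    refine ⟨v * -coeff β rem, ?_⟩
    have hv' := congrArg ι hv
    rw [map_mul, map_one] at hv'
    rw [hcu, map_mul, map_neg]
    simp only [zero_add, coeff_map, map_mul, constantCoeff_X, zero_mul, zero_sub] at h2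
    linear_combination constantCoeff u * hv' - ι v * h2

end Integrality

/-! ### Expansion of the shift operators in powers of `z` -/

section Expansion

/-- The coefficient of `z ^ i` of a power series in `q` over `k⟦z⟧`. -/
def zCoeff {k : Type*} [CommRing k] (i : ℕ) (f : PowerSeries (PowerSeries k)) : PowerSeries k :=
  mk fun β => coeff i (coeff β f)

section Basic

variable {k : Type*} [CommRing k] (i : ℕ) (f g : PowerSeries (PowerSeries k)) (h : PowerSeries k)

theorem zCoeff_add : zCoeff i (f + g) = zCoeff i f + zCoeff i g := by ext; simp [zCoeff]

theorem zCoeff_map_C_mul : zCoeff i (map C h * f) = h * zCoeff i f := by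
  ext β
  simp only [zCoeff, coeff_mk, coeff_mul β, map_sum, coeff_map, coeff_C_mul]

theorem zCoeff_C_C_mul (c : k) : zCoeff i (C (C c) * f) = C c * zCoeff i f := by
  ext β
  simp [zCoeff]

theorem zCoeff_zero_C_X_mul : zCoeff 0 (C X * f) = 0 := by ext; simp [zCoeff]

theorem zCoeff_succ_C_X_mul : zCoeff (i + 1) (C X * f) = zCoeff i f := by
  ext β
  rw [zCoeff, zCoeff, coeff_mk, coeff_mk, coeff_C_mul, coeff_succ_X_mul]

theorem zCoeff_euler : zCoeff i (euler _ f) = euler k (zCoeff i f) := by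
  ext β
  have : ((β : ℕ) : PowerSeries k) = C (β : k) := by simp
  rw [zCoeff, coeff_mk, coeff_euler, coeff_euler, zCoeff, coeff_mk, this, coeff_C_mul]

end Basic

variable {k : Type*} [Field k] {ℓ J w : PowerSeries k}

theorem zCoeff_zero_shiftProd (cs : List k) (f : PowerSeries (PowerSeries k)) :
    zCoeff 0 (shiftProd X (map C ℓ) (cs.map C) f) = ℓ ^ cs.length * zCoeff 0 f := by
  have hp : (map C ℓ : PowerSeries (PowerSeries k)) ^ cs.length = map C (ℓ ^ cs.length) := by simp
  rw [shiftProd_eq, zCoeff_add, zCoeff_zero_C_X_mul, List.length_map, hp, zCoeff_map_C_mul,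
    add_zero]

theorem zCoeff_succ_shiftProd (i : ℕ) (cs : List k) (f : PowerSeries (PowerSeries k)) :
    zCoeff (i + 1) (shiftProd X (map C ℓ) (cs.map C) f) =
      ℓ ^ cs.length * zCoeff (i + 1) f + zCoeff i (shiftRem X (map C ℓ) (cs.map C) f) := by
  have hp : (map C ℓ : PowerSeries (PowerSeries k)) ^ cs.length = map C (ℓ ^ cs.length) := by simp
  rw [shiftProd_eq, zCoeff_add, zCoeff_succ_C_X_mul, List.length_map, hp, zCoeff_map_C_mul]

/-- The operator of first order which is the leading part of `shiftRem` for a list of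
length `m` with sum `s`, up to the factor `ℓ ^ (m - 1)`; here `w` is the logarithmic derivative
of `ℓ`. -/
def firstOp (w : PowerSeries k) (m s : k) (F : PowerSeries k) : PowerSeries k :=
  C m * euler k F + C (m * (m - 1) / 2) * w * F + C s * F

/-- The operator of second order which is the next part of `shiftRem` for a list of length `m` with
sum `s` and sum of squares `p`, up to the factor `ℓ ^ (m - 2)`. -/
def secondOp (w : PowerSeries k) (m s p : k) (F : PowerSeries k) : PowerSeries k :=
  C (m * (m - 1) / 2) * euler k (euler k F) + C (m * (m - 1) * (m - 2) / 2) * w * euler k F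
    + C (m * (m - 1) * (m - 2) / 6) * (euler k w + w ^ 2) * F
    + C (m * (m - 1) * (m - 2) * (m - 3) / 8) * w ^ 2 * F
    + C s * (C (m - 1) * euler k F + C ((m - 1) * (m - 2) / 2) * w * F)
    + C ((s ^ 2 - p) / 2) * F

theorem euler_pow_of_log (hw : euler k ℓ = ℓ * w) (m : ℕ) :
    euler k (ℓ ^ m) = C (m : k) * ℓ ^ m * w := by
  rw [euler_pow, hw]
  cases m with
  | zero => simp
  | succ m => simp [pow_succ]; ring

theorem euler_inv_of_log (hJ : ℓ * J = 1) (hw : euler k ℓ = ℓ * w) : euler k J = -J * w := by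
  have h := congrArg (euler k) hJ
  rw [euler_mul, hw, Derivation.map_one_eq_zero] at h
  linear_combination J * h - (euler k J + J * w) * hJ

/-- The coefficient of `z` in `∏_c (ℓ + z q d/dq + c z) f`, without the contribution
`ℓ ^ m` times the coefficient of `z` in `f`; here `J = ℓ⁻¹`. -/
theorem zCoeff_zero_shiftRem [CharZero k] (hJ : ℓ * J = 1) (hw : euler k ℓ = ℓ * w) (cs : List k)
    (f : PowerSeries (PowerSeries k)) :
    zCoeff 0 (shiftRem X (map C ℓ) (cs.map C) f) =
      J * ℓ ^ cs.length * firstOp w cs.length cs.sum (zCoeff 0 f) := by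
  induction cs with
  | nil => ext; simp [shiftRem, zCoeff, firstOp]
  | cons c cs ih =>
    rw [List.map_cons, shiftRem, zCoeff_add, zCoeff_add, zCoeff_map_C_mul, zCoeff_C_C_mul,
      zCoeff_euler, zCoeff_zero_shiftProd, ih, euler_mul, euler_pow_of_log hw, List.length_cons,
      List.sum_cons, firstOp, firstOp]
    set m : k := (cs.length : k) with hm
    set M := ℓ ^ cs.length
    set F := zCoeff 0 f
    have e1 : C ((m + 1) * (m + 1 - 1) / 2) = C (m * (m - 1) / 2) + C m := by
      rw [← map_add]; congr 1; ring
    rw [pow_succ]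
    push_cast
    rw [← hm, e1, map_add, map_add, map_one]
    linear_combination (-M * (euler k F + C c * F + C m * w * F)) * hJ

/-- The coefficient of `z ^ 2` in `∏_c (ℓ + z q d/dq + c z) f`, without the contribution
`ℓ ^ m` times the coefficient of `z ^ 2` in `f`; here `J = ℓ⁻¹`. -/
theorem zCoeff_one_shiftRem [CharZero k] (hJ : ℓ * J = 1) (hw : euler k ℓ = ℓ * w) (cs : List k)
    (f : PowerSeries (PowerSeries k)) :
    zCoeff 1 (shiftRem X (map C ℓ) (cs.map C) f) =
      J * ℓ ^ cs.length * firstOp w cs.length cs.sum (zCoeff 1 f) +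
      J ^ 2 * ℓ ^ cs.length *
        secondOp w cs.length cs.sum (cs.map fun c => c ^ 2).sum (zCoeff 0 f) := by
  induction cs with
  | nil => ext; simp [shiftRem, zCoeff, firstOp, secondOp]
  | cons c cs ih =>
    rw [List.map_cons, shiftRem, zCoeff_add, zCoeff_add, zCoeff_map_C_mul, zCoeff_C_C_mul,
      zCoeff_euler, zCoeff_succ_shiftProd, ih, zCoeff_zero_shiftRem hJ hw, map_add, euler_mul,
      euler_mul, euler_mul J, euler_pow_of_log hw, euler_inv_of_log hJ hw, List.length_cons,
      List.sum_cons, List.map_cons, List.sum_cons, firstOp, firstOp, firstOp, secondOp, secondOp]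
    set m : k := (cs.length : k) with hm
    set M := ℓ ^ cs.length
    set F := zCoeff 0 f
    set G := zCoeff 1 f
    set s := cs.sum
    set p := (cs.map fun c => c ^ 2).sum
    have eC (a : k) : euler k (C a) = 0 := by rw [euler_apply, derivative_C, mul_zero]
    -- `ring` has no division in `k⟦q⟧`: all denominators are written in terms of the one constant
    -- `24⁻¹`
    have i2 : (2 : k)⁻¹ = 12 * 24⁻¹ := by norm_num
    have i6 : (6 : k)⁻¹ = 4 * 24⁻¹ := by norm_num
    have i8 : (8 : k)⁻¹ = 3 * 24⁻¹ := by norm_num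
    have h24 : (C (24⁻¹ : k) * 24 : PowerSeries k) = 1 := by
      rw [← map_ofNat C 24, ← map_mul, inv_mul_cancel₀ (by norm_num), map_one]
    have e12 : euler k (12 : PowerSeries k) = 0 := by rw [← map_ofNat C 12, eC]
    have e1 : euler k (1 : PowerSeries k) = 0 := Derivation.map_one_eq_zero _
    rw [pow_succ]
    push_cast
    rw [← hm]
    simp only [map_add, euler_mul, eC, div_eq_mul_inv, i2, i6, i8, map_mul, map_sub, map_one,
      map_ofNat, map_pow, e12, e1]
    generalize (C (24⁻¹ : k) : PowerSeries k) = τ at h24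
    generalize (C m : PowerSeries k) = μ
    generalize (C s : PowerSeries k) = σ
    generalize (C c : PowerSeries k) = γ
    generalize (C p : PowerSeries k) = π
    generalize euler k (euler k F) = F2
    generalize euler k F = F1
    generalize euler k G = G1
    generalize euler k w = w1
    linear_combination
      (M * (-G1 - τ * 24 * μ * w * G - γ * G) + J * M * (
        (μ * (μ - 1) * 12 * τ * F2 + μ * (μ - 1) * (μ - 2) * 12 * τ * w * F1
          + μ * (μ - 1) * (μ - 2) * 4 * τ * (w1 + w ^ 2) * F
          + μ * (μ - 1) * (μ - 2) * (μ - 3) * 3 * τ * w ^ 2 * F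
          + σ * ((μ - 1) * F1 + (μ - 1) * (μ - 2) * 12 * τ * w * F)
          + (σ ^ 2 - π) * 12 * τ * F)
        - ((μ + 1) * μ * 12 * τ * F2 + (μ + 1) * μ * (μ - 1) * 12 * τ * w * F1
          + (μ + 1) * μ * (μ - 1) * 4 * τ * (w1 + w ^ 2) * F
          + (μ + 1) * μ * (μ - 1) * (μ - 2) * 3 * τ * w ^ 2 * F
          + (γ + σ) * (μ * F1 + μ * (μ - 1) * 12 * τ * w * F)
          + ((γ + σ) ^ 2 - (γ ^ 2 + π)) * 12 * τ * F))) * hJ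
      - (μ * M * w * G + J * M * (
          σ * (μ - 1) * F1 - (γ + σ) * μ * F1
          + (μ - 1) * w * (μ * F1 + σ * F) + μ * F2 + σ * F1
          + γ * (μ * F1 + σ * F))) * h24

end Expansion

/-! ### The algebraic equation for `L` -/

/-- The equation `ℓ ^ n - 1 = κ q ℓ ^ t` has a solution with constant term `1`: in terms of
`u = ℓ - 1` it says that `u` is the compositional inverse of
`((1 + X) ^ n - 1) / (κ (1 + X) ^ t)`. -/
theorem exists_pow_sub_one_eq {k : Type*} [Field k] [CharZero k] {n : ℕ} (hn : n ≠ 0) (t : ℕ)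
    {κ : k} (hκ : κ ≠ 0) :
    ∃ ℓ : PowerSeries k, constantCoeff ℓ = 1 ∧ ℓ ^ n - 1 = C κ * X * ℓ ^ t := by
  set P : PowerSeries k := C κ⁻¹ * ((1 + X) ^ n - 1) * ((1 + X) ^ t)⁻¹ with hP
  have hPe : C κ * P * (1 + X) ^ t = (1 + X) ^ n - 1 := by
    have h1 : (C κ * C κ⁻¹ : PowerSeries k) = 1 := by
      rw [← map_mul, mul_inv_cancel₀ hκ, map_one]
    have h2 : ((1 + X : PowerSeries k) ^ t)⁻¹ * (1 + X) ^ t = 1 :=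
      PowerSeries.inv_mul_cancel _ (by simp)
    rw [hP]
    linear_combination ((1 + X) ^ n - 1) * ((1 + X : PowerSeries k) ^ t)⁻¹ * (1 + X) ^ t * h1 +
      ((1 + X) ^ n - 1) * h2
  have hP0 : constantCoeff P = 0 := by simp [hP]
  have hP1 : coeff 1 P = κ⁻¹ * n := by
    have h0 : coeff 1 ((1 + X : PowerSeries k) ^ n - 1) = (n : k) := by
      have := coeff_derivative ((1 + X : PowerSeries k) ^ n - 1) 0
      rw [map_sub, derivative_pow] at this
      simpa [coeff_zero_eq_constantCoeff_apply] using this.symm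
    rw [hP, mul_assoc, coeff_C_mul, coeff_one_mul, h0]
    simp
  have hu : IsUnit (coeff 1 P) := by
    rw [hP1]
    exact (mul_ne_zero (inv_ne_zero hκ) (by exact_mod_cast hn)).isUnit
  set u := substInvOfIsUnit P hu with hudef
  have hu0 : constantCoeff u = 0 := constantCoeff_substInvOfIsUnit P hu
  have hs : HasSubst u := HasSubst.of_constantCoeff_zero' hu0
  have hPu : P.subst u = X := subst_substInvOfIsUnit_right P hP0 hu
  have h := congrArg (fun p : PowerSeries k => (p.subst u : PowerSeries k)) hPe
  have h1 : ((1 : PowerSeries k).subst u : PowerSeries k) = 1 := by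
    rw [← coe_substAlgHom hs, map_one]
  have hC : ((C κ : PowerSeries k).subst u : PowerSeries k) = C κ := subst_C _
  simp only [subst_mul hs, subst_pow hs, subst_add hs, subst_sub hs, subst_X hs, h1, hPu, hC] at h
  exact ⟨1 + u, by simp [hu0], h.symm⟩

/-! ### The differential equation of the hypergeometric series -/

section DifferentialEquation

variable {r : ℕ} (d : Fin r → ℕ)

/-- The constants `i / d_k`, for `1 ≤ i ≤ d_k`. -/
def factors : List ℂ :=
  (Finset.univ.sigma fun k => Finset.range (d k)).toList.map fun p => ((p.2 : ℂ) + 1) / d p.1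

theorem length_factors : (factors d).length = totalDegree d := by
  simp [factors, totalDegree]

theorem sum_map_factors (h : ℂ → ℂ) :
    ((factors d).map h).sum = ∑ k, ∑ i ∈ Finset.range (d k), h (((i : ℂ) + 1) / d k) := by
  rw [factors, List.map_map, Finset.sum_map_toList, Finset.sum_sigma]
  rfl

theorem prod_map_factors {A : Type*} [CommRing A] (h : ℂ → A) :
    ((factors d).map h).prod = ∏ k, ∏ i ∈ Finset.range (d k), h (((i : ℂ) + 1) / d k) := by
  rw [factors, List.map_map, Finset.prod_map_toList, Finset.prod_sigma]
  rfl

variable {d}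

theorem sum_factors (hd : ∀ k, 1 ≤ d k) : (factors d).sum = (totalDegree d + r) / 2 := by
  have h1 (m : ℕ) : ∑ i ∈ Finset.range m, ((i : ℂ) + 1) = m * (m + 1) / 2 := by
    induction m with
    | zero => simp
    | succ m ih => rw [Finset.sum_range_succ, ih]; push_cast; ring
  have h2 (k : Fin r) : ∑ i ∈ Finset.range (d k), ((i : ℂ) + 1) / d k = ((d k : ℂ) + 1) / 2 := by
    have : (d k : ℂ) ≠ 0 := by exact_mod_cast (Nat.one_le_iff_ne_zero.mp (hd k))
    rw [← Finset.sum_div, h1]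
    field_simp
  have h3 := sum_map_factors d id
  simp only [List.map_id, id, h2] at h3
  rw [h3, ← Finset.sum_div, Finset.sum_add_distrib, totalDegree]
  simp

theorem sum_sq_factors (hd : ∀ k, 1 ≤ d k) :
    ((factors d).map fun c => c ^ 2).sum =
      (2 * totalDegree d + 3 * r + ∑ k, 1 / (d k : ℂ)) / 6 := by
  have h1 (m : ℕ) :
      ∑ i ∈ Finset.range m, ((i : ℂ) + 1) ^ 2 = (m : ℂ) * (m + 1) * (2 * m + 1) / 6 := by
    induction m with
    | zero => simp
    | succ m ih => rw [Finset.sum_range_succ, ih]; push_cast; ring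
  have h2 (k : Fin r) : ∑ i ∈ Finset.range (d k), (((i : ℂ) + 1) / d k) ^ 2 =
      (2 * (d k : ℂ) + 3 + 1 / d k) / 6 := by
    have : (d k : ℂ) ≠ 0 := by exact_mod_cast (Nat.one_le_iff_ne_zero.mp (hd k))
    simp only [div_pow]
    rw [← Finset.sum_div, h1]
    field_simp
    ring
  rw [sum_map_factors]
  simp only [h2]
  rw [← Finset.sum_div, Finset.sum_add_distrib, Finset.sum_add_distrib, ← Finset.mul_sum,
    totalDegree]
  push_cast
  simp
  ring

theorem selfPower_ne_zero (hd : ∀ k, 1 ≤ d k) : (selfPower d : ℂ) ≠ 0 := by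
  have : selfPower d ≠ 0 :=
    Finset.prod_ne_zero_iff.mpr fun k _ => pow_ne_zero _ (Nat.one_le_iff_ne_zero.mp (hd k))
  exact_mod_cast this

theorem natCast_eq_C (m : ℕ) : (m : LaurentSeries ℂ) = HahnSeries.C (m : ℂ) :=
  (map_natCast _ m).symm

theorem one_add_mul_z_pow_sub_one_ne_zero {n j : ℕ} (hn : n ≠ 0) (hj : j ≠ 0) :
    (1 + (j : LaurentSeries ℂ) * z) ^ n - 1 ≠ 0 := by
  have h : (1 + (j : LaurentSeries ℂ) * z) ^ n - 1 =
      HahnSeries.ofPowerSeries ℤ ℂ ((1 + C (j : ℂ) * X) ^ n - 1) := by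
    simp [z]
  rw [h, Ne, map_eq_zero_iff _ HahnSeries.ofPowerSeries_injective]
  intro h0
  have h1 := congrArg (fun f => coeff 0 (derivative ℂ f)) h0
  simp [Derivation.leibniz] at h1
  tauto

/-- The ratio of consecutive coefficients of `φ`. -/
theorem coeff_phi_succ (n : ℕ) (hn : n ≠ 0) (hd : ∀ k, 1 ≤ d k) (β : ℕ) :
    ((1 + ((β + 1 : ℕ) : LaurentSeries ℂ) * z) ^ n - 1) * coeff (β + 1) (phi n d) =
      (selfPower d : LaurentSeries ℂ) *
        ((factors d).map fun c => 1 + z * ((β : LaurentSeries ℂ) + HahnSeries.C c)).prod *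
          coeff β (phi n d) := by
  have hnum : (∏ k : Fin r, ∏ i ∈ Finset.Icc 1 (d k * (β + 1)),
      ((d k : LaurentSeries ℂ) + (i : LaurentSeries ℂ) * z)) =
      (selfPower d : LaurentSeries ℂ) *
        ((factors d).map fun c => 1 + z * ((β : LaurentSeries ℂ) + HahnSeries.C c)).prod *
      ∏ k : Fin r, ∏ i ∈ Finset.Icc 1 (d k * β),
        ((d k : LaurentSeries ℂ) + (i : LaurentSeries ℂ) * z) := by
    rw [prod_map_factors, selfPower]
    push_cast
    rw [← Finset.prod_mul_distrib, ← Finset.prod_mul_distrib]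
    refine Finset.prod_congr rfl fun k _ => ?_
    have hI (m : ℕ) (h : ℕ → LaurentSeries ℂ) :
        ∏ i ∈ Finset.Icc 1 m, h i = ∏ i ∈ Finset.range m, h (i + 1) := by
      rw [Finset.range_eq_Ico, Finset.prod_Ico_add' h 0 m 1]; rfl
    rw [hI, hI, mul_add, mul_one, Finset.prod_range_add, mul_comm]
    congr 1
    rw [← Finset.card_range (d k), ← Finset.prod_const, Finset.card_range,
      ← Finset.prod_mul_distrib]
    refine Finset.prod_congr rfl fun i _ => ?_
    have h0 : (d k : ℂ) ≠ 0 := by exact_mod_cast (Nat.one_le_iff_ne_zero.mp (hd k))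
    have h1 : (d k : LaurentSeries ℂ) * HahnSeries.C (((i : ℂ) + 1) / d k) =
        (i : LaurentSeries ℂ) + 1 := by
      rw [natCast_eq_C, ← map_mul, mul_div_cancel₀ _ h0, map_add, map_natCast, map_one]
    push_cast
    linear_combination -z * h1
  have hden := one_add_mul_z_pow_sub_one_ne_zero hn (Nat.succ_ne_zero β)
  rw [phi, coeff_mk, coeff_mk, hnum, Finset.prod_Icc_succ_top (by omega)]
  field_simp

/-- `φ` satisfies `((1 + z q d/dq) ^ n - 1) φ = d^d q ∏_k ∏_i (1 + z q d/dq + (i / d_k) z) φ`. -/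
theorem shiftProd_phi (n : ℕ) (hn : n ≠ 0) (hd : ∀ k, 1 ≤ d k) :
    shiftProd z 1 (List.replicate n 0) (phi n d) - phi n d =
      C (selfPower d : LaurentSeries ℂ) * X *
        shiftProd z 1 ((factors d).map HahnSeries.C) (phi n d) := by
  ext1 β
  rw [map_sub, coeff_shiftProd_one, mul_assoc, coeff_C_mul]
  cases β with
  | zero => simp
  | succ β =>
    rw [coeff_succ_X_mul, coeff_shiftProd_one, List.map_map]
    have h := coeff_phi_succ n hn hd β
    simp only [List.map_replicate, List.prod_replicate, Function.comp_def]
    push_cast at h ⊢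
    linear_combination h

theorem constantCoeff_phi (n : ℕ) : constantCoeff (phi n d) = 1 := by
  rw [← coeff_zero_eq_constantCoeff_apply, phi, coeff_mk]
  simp

end DifferentialEquation

/-! ### The residue of `ln φ` and the regular factor `Q` -/

section RegularFactor

variable {r : ℕ} {d : Fin r → ℕ}

/-- The inclusion of power series in `z` into Laurent series in `z`. -/
def toLaurent : PowerSeries ℂ →+* LaurentSeries ℂ := HahnSeries.ofPowerSeries ℤ ℂ

theorem toLaurent_X : toLaurent X = z := HahnSeries.ofPowerSeries_X

theorem toLaurent_C (a : ℂ) : toLaurent (C a) = HahnSeries.C a := HahnSeries.ofPowerSeries_C a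

theorem toLaurent_injective : Function.Injective toLaurent := HahnSeries.ofPowerSeries_injective

theorem coeff_toLaurent_of_neg (f : PowerSeries ℂ) {m : ℤ} (hm : m < 0) :
    (toLaurent f).coeff m = 0 := by
  rw [toLaurent, HahnSeries.ofPowerSeries_apply]
  refine HahnSeries.embDomain_of_notMem_range ?_
  rintro ⟨a, ha⟩
  simp at ha
  omega

theorem coeff_toLaurent (f : PowerSeries ℂ) (m : ℕ) : (toLaurent f).coeff m = coeff m f :=
  HahnSeries.ofPowerSeries_apply_coeff f m

theorem z_ne_zero : z ≠ 0 := by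
  rw [← toLaurent_X, Ne, map_eq_zero_iff _ toLaurent_injective]
  exact X_ne_zero

theorem map_toLaurent_map_C (f : PowerSeries ℂ) :
    map toLaurent (map C f) = map (HahnSeries.C : ℂ →+* LaurentSeries ℂ) f := by
  ext1 β
  simp only [coeff_map, toLaurent_C]

/-- The exponential factor `e^{-m(q)/z}`. -/
def expFactor (m : PowerSeries ℂ) : PowerSeries (LaurentSeries ℂ) :=
  (exp (LaurentSeries ℂ)).subst
    (-(C z⁻¹ * map HahnSeries.C m) : PowerSeries (LaurentSeries ℂ))

theorem constantCoeff_expArg {m : PowerSeries ℂ} (hm : constantCoeff m = 0) :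
    constantCoeff (-(C z⁻¹ * map HahnSeries.C m) : PowerSeries (LaurentSeries ℂ)) = 0 := by
  have : constantCoeff (map (HahnSeries.C : ℂ →+* LaurentSeries ℂ) m) = 0 := by
    rw [← coeff_zero_eq_constantCoeff_apply, coeff_map, coeff_zero_eq_constantCoeff_apply, hm,
      map_zero]
  rw [map_neg, map_mul, this, mul_zero, neg_zero]

theorem constantCoeff_expFactor {m : PowerSeries ℂ} (hm : constantCoeff m = 0) :
    constantCoeff (expFactor m) = 1 := by
  rw [expFactor, constantCoeff_subst_of_zero (constantCoeff_expArg hm), constantCoeff_exp]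

theorem euler_expFactor {m : PowerSeries ℂ} (hm : constantCoeff m = 0) :
    euler _ (expFactor m) =
      -(C z⁻¹ * map HahnSeries.C (euler ℂ m)) * expFactor m := by
  rw [expFactor, euler_exp_subst (constantCoeff_expArg hm), map_neg, euler_C_mul, euler_map]

/-- If `e^{-m/z} φ` is holomorphic at `z = 0`, then `m` is the residue of `ln φ`. -/
theorem mu_eq_of_expFactor_mul_phi {n : ℕ} {m : PowerSeries ℂ} (hm : constantCoeff m = 0)
    {F : PowerSeries (PowerSeries ℂ)} (hF : map toLaurent F = expFactor m * phi n d) :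
    mu n d = m := by
  have hφ := constantCoeff_phi (d := d) n
  have hF1 : constantCoeff F = 1 := by
    apply toLaurent_injective
    rw [map_one, ← coeff_zero_eq_constantCoeff_apply, ← coeff_map, hF,
      coeff_zero_eq_constantCoeff_apply, map_mul, constantCoeff_expFactor hm, hφ, mul_one]
  -- `D ln φ = z⁻¹ D m + D F / F`, and the last term has no pole because `F` is a unit
  obtain ⟨H, hH⟩ : ∃ H, F * H = 1 := (isUnit_iff_constantCoeff.mpr (by simp [hF1])).exists_right_inv
  have hlog := mul_euler_logOf hφ
  have hD := congrArg (euler _) hF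
  rw [euler_map, euler_mul, euler_expFactor hm] at hD
  have hHK := congrArg (map toLaurent) hH
  rw [map_mul, map_one, hF] at hHK
  have key : euler _ (logOf (phi n d)) =
      C z⁻¹ * map HahnSeries.C (euler ℂ m) + map toLaurent (H * euler _ F) := by
    rw [map_mul]
    linear_combination (C z⁻¹ * map HahnSeries.C (euler ℂ m) - euler _ (logOf (phi n d))) * hHK +
      map toLaurent H * expFactor m * hlog - map toLaurent H * hD
  ext β
  rcases Nat.eq_zero_or_pos β with rfl | hβ
  · rw [mu, coeff_mk, coeff_zero_eq_constantCoeff_apply, coeff_zero_eq_constantCoeff_apply, hm,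
      constantCoeff_logOf hφ]
    rfl
  · have h := congrArg (fun p => (coeff β p).coeff (-1)) key
    simp only [map_add, coeff_euler, coeff_C_mul, coeff_map] at h
    have hz : (z⁻¹ : LaurentSeries ℂ) = HahnSeries.single (-1) 1 := by
      rw [z, HahnSeries.inv_single]; simp
    have hβ' : (β : ℂ) ≠ 0 := by exact_mod_cast hβ.ne'
    rw [HahnSeries.coeff_add, coeff_toLaurent_of_neg _ (by norm_num), natCast_eq_C,
      HahnSeries.C_mul_eq_smul, HahnSeries.coeff_smul, add_zero, hz,
      mul_comm (HahnSeries.single _ _), HahnSeries.C_mul_eq_smul, HahnSeries.coeff_smul,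
      HahnSeries.coeff_single_same, smul_eq_mul, smul_eq_mul, mul_one] at h
    rw [mu, coeff_mk]
    exact mul_left_cancel₀ hβ' h

/-- The regular factor `Q` is defined over `ℂ⟦z⟧`, the series `L` is algebraic, and `Q` satisfies
the differential equation obtained from that of `φ` by conjugation with `e^{μ/z}` and division
by `z`. -/
theorem exists_regular_factor {n : ℕ} (hn : n ≠ 0) (hd : ∀ k, 1 ≤ d k) :
    constantCoeff (L n d) = 1 ∧
    L n d ^ n - 1 = C (selfPower d : ℂ) * X * L n d ^ totalDegree d ∧
    ∃ F : PowerSeries (PowerSeries ℂ), map toLaurent F = Q n d ∧ constantCoeff F = 1 ∧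
      shiftRem X (map C (L n d)) ((List.replicate n 0).map C) F =
        map C (C (selfPower d : ℂ) * X) *
          shiftRem X (map C (L n d)) ((factors d).map C) F := by
  obtain ⟨ℓ, hℓ1, hℓ⟩ := exists_pow_sub_one_eq hn (totalDegree d) (selfPower_ne_zero hd)
  set κ : ℂ := (selfPower d : ℂ) with hκ
  set m : PowerSeries ℂ := mk fun β => coeff β ℓ / β with hmdef
  have hm : constantCoeff m = 0 := by
    rw [← coeff_zero_eq_constantCoeff_apply, hmdef, coeff_mk]; simp
  have hmℓ : euler ℂ m = ℓ - 1 := by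
    ext β
    rcases Nat.eq_zero_or_pos β with rfl | hβ
    · simp [hℓ1]
    · have hβ' : (β : ℂ) ≠ 0 := by exact_mod_cast hβ.ne'
      rw [coeff_euler, hmdef, coeff_mk, map_sub, coeff_one, if_neg hβ.ne', mul_div_cancel₀ _ hβ',
        sub_zero]
  set E := expFactor m with hE
  have hE' : C z * euler _ E = -(map HahnSeries.C (ℓ - 1)) * E := by
    have hz : (C z * C z⁻¹ : PowerSeries (LaurentSeries ℂ)) = 1 := by
      rw [← map_mul, mul_inv_cancel₀ z_ne_zero, map_one]
    rw [euler_expFactor hm, hmℓ]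
    linear_combination -(map HahnSeries.C (ℓ - 1)) * E * hz
  set ℓK : PowerSeries (LaurentSeries ℂ) := map HahnSeries.C ℓ with hℓK
  have hconj (cs : List (LaurentSeries ℂ)) :
      shiftProd z ℓK cs (E * phi n d) = E * shiftProd z 1 cs (phi n d) := by
    rw [shiftProd_conj z ℓK hE', map_sub, map_one, ← hℓK]
    congr 2
    ring
  have hκK : (C (selfPower d : LaurentSeries ℂ) * X : PowerSeries (LaurentSeries ℂ)) =
      map HahnSeries.C (C κ * X) := by
    rw [map_mul, map_C, map_X, hκ, ← natCast_eq_C]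
  have hℓa := congrArg (map (HahnSeries.C : ℂ →+* LaurentSeries ℂ)) hℓ
  rw [map_sub, map_one, map_mul, map_pow, map_pow, ← hκK, ← hℓK] at hℓa
  have heq : shiftRem z ℓK (List.replicate n 0) (E * phi n d) =
      C (selfPower d : LaurentSeries ℂ) * X *
        shiftRem z ℓK ((factors d).map HahnSeries.C) (E * phi n d) := by
    have h1 := shiftProd_phi n hn hd
    have h2 := hconj (List.replicate n 0)
    have h3 := hconj ((factors d).map HahnSeries.C)
    rw [shiftProd_eq, List.length_replicate] at h2
    rw [shiftProd_eq, List.length_map, length_factors] at h3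
    have hz : (C z : PowerSeries (LaurentSeries ℂ)) ≠ 0 := by
      rw [Ne, map_eq_zero_iff _ C_injective]; exact z_ne_zero
    -- after multiplication by `z` the terms free of `z` cancel by the equation for `ℓ`
    apply mul_left_cancel₀ hz
    linear_combination h2 - C (selfPower d : LaurentSeries ℂ) * X * h3 + E * h1 -
      E * phi n d * hℓa
  have hℓC : map toLaurent (map C ℓ) = ℓK := map_toLaurent_map_C ℓ
  have hcs (cs : List ℂ) : (cs.map C).map toLaurent = cs.map HahnSeries.C := by
    rw [List.map_map]
    exact List.map_congr_left fun c _ => toLaurent_C c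
  have hκC : map toLaurent (C (C κ)) * X =
      (C (selfPower d : LaurentSeries ℂ) * X : PowerSeries (LaurentSeries ℂ)) := by
    rw [map_C, toLaurent_C, hκ, ← natCast_eq_C]
  have hEφ : constantCoeff (E * phi n d) = 1 := by
    rw [map_mul, constantCoeff_expFactor hm, constantCoeff_phi, mul_one]
  obtain ⟨F, hF⟩ := exists_map_eq_of_shiftRem_eq toLaurent hn (map C ℓ) (C (C κ))
    (by rw [← coeff_zero_eq_constantCoeff_apply, coeff_map, coeff_zero_eq_constantCoeff_apply,
      hℓ1, map_one]) ((factors d).map C) (E * phi n d) hEφ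
    (by rw [toLaurent_X, hℓC, hcs, hκC]; exact heq)
  have hmu := mu_eq_of_expFactor_mul_phi hm hF
  have hL : L n d = ℓ := by
    rw [L, hmu, ← euler_apply, hmℓ]; ring
  rw [hL]
  refine ⟨hℓ1, hℓ, F, ?_, ?_, ?_⟩
  · rw [hF, Q, hmu]; rfl
  · apply toLaurent_injective
    rw [map_one, ← hEφ, ← hF, ← coeff_zero_eq_constantCoeff_apply,
      ← coeff_zero_eq_constantCoeff_apply, coeff_map]
  · have hinj : Function.Injective (map toLaurent) := by
      intro f g h
      ext1 β
      exact toLaurent_injective (by rw [← coeff_map, h, coeff_map])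
    apply hinj
    rw [map_mul, ← shiftRem_map, ← shiftRem_map, toLaurent_X, hℓC, hcs, hcs, hF,
      map_toLaurent_map_C, ← hκK, ← heq]
    simp

theorem holomorphicAtZero_of_map {F : PowerSeries (PowerSeries ℂ)}
    {G : PowerSeries (LaurentSeries ℂ)} (h : map toLaurent F = G) : HolomorphicAtZero G := by
  intro β m hm
  rw [← h, coeff_map, coeff_toLaurent_of_neg _ hm]

theorem Phi_zero_eq {n : ℕ} {F : PowerSeries (PowerSeries ℂ)} (h : map toLaurent F = Q n d) :
    Phi n d 0 = zCoeff 0 F := by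
  ext β
  rw [Phi, coeff_mk, ← h, coeff_map, zCoeff, coeff_mk]
  exact coeff_toLaurent _ 0

theorem Phi_one_eq {n : ℕ} {F : PowerSeries (PowerSeries ℂ)} (h : map toLaurent F = Q n d) :
    Phi n d 1 = zCoeff 1 F := by
  ext β
  rw [Phi, coeff_mk, ← h, coeff_map, zCoeff, coeff_mk, LaurentSeries.derivative_iterate_coeff]
  simpa using coeff_toLaurent (coeff β F) 1

end RegularFactor

/-! ### The first two transport equations -/

section Transport

variable {k : Type*} [Field k] {n t r σ : k} {N S I J w G : PowerSeries k}

/-- The operator of the transport equations, `ℓ ^ n = N` and `d^d q ℓ ^ t = N - 1` being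
substituted in the equation for `Q`. -/
def transport (n t s : k) (N w F : PowerSeries k) : PowerSeries k :=
  N * firstOp w n 0 F - (N - 1) * firstOp w t s F

/-- The inhomogeneous term of the second transport equation is `ℓ⁻¹` times `source`, applied
to `Φ₀`. -/
def source (n t s p : k) (N w F : PowerSeries k) : PowerSeries k :=
  N * secondOp w n 0 0 F - (N - 1) * secondOp w t s p F

theorem transport_sub (s : k) (F F' : PowerSeries k) :
    transport n t s N w (F - F') = transport n t s N w F - transport n t s N w F' := by
  simp only [transport, firstOp, map_sub]; ring

/-- A solution of a transport equation is determined by its constant term. -/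
theorem eq_of_transport_eq [CharZero k] (hn : n ≠ 0)
    (hS : C n * S = C (n - t) * N + C t) (hI : S * I = 1)
    (hN1 : constantCoeff N = 1) (hw0 : constantCoeff w = 0) {s : k} {F F' : PowerSeries k}
    (h : transport n t s N w F = transport n t s N w F')
    (h0 : constantCoeff F = constantCoeff F') : F = F' := by
  have hn1 : (C n⁻¹ * C n : PowerSeries k) = 1 := by
    rw [← map_mul, inv_mul_cancel₀ hn, map_one]
  refine sub_eq_zero.mp (eq_zero_of_euler_eq_mul
    (b := -(C n⁻¹ * I * (N * C (n * (n - 1) / 2) * w - (N - 1) * (C (t * (t - 1) / 2) * w + C s))))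
    (by simp [hN1, hw0]) (by simp [h0]) ?_)
  have h1 := transport_sub (n := n) (t := t) (N := N) (w := w) s F F'
  rw [h, sub_self] at h1
  generalize F - F' = Y at h1
  simp only [transport, firstOp, map_zero, map_sub] at h1 hS
  linear_combination C n⁻¹ * I * h1 + C n⁻¹ * I * euler k Y * hS - euler k Y * hn1 -
    C n⁻¹ * C n * euler k Y * hI

theorem euler_C (a : k) : euler k (C a) = 0 := by rw [euler_apply, derivative_C, mul_zero]

theorem euler_of_mul_eq_one (hn : n ≠ 0) (hS : C n * S = C (n - t) * N + C t) (hI : S * I = 1)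
    (hN : euler k N = C n * N * w) : euler k I = -(C (n - t) * N * w * I ^ 2) := by
  have h1 := congrArg (euler k) hS
  rw [euler_C_mul, map_add, euler_C_mul, euler_C, hN] at h1
  have hC : (C n : PowerSeries k) ≠ 0 := by rwa [Ne, map_eq_zero_iff _ C_injective]
  have h2 : euler k S = C (n - t) * N * w := by
    apply mul_left_cancel₀ hC
    linear_combination h1
  have h3 := congrArg (euler k) hI
  rw [euler_mul, Derivation.map_one_eq_zero, h2] at h3
  linear_combination I * h3 - euler k I * hI

theorem euler_log_derivative (hn : n ≠ 0) (hS : C n * S = C (n - t) * N + C t) (hI : S * I = 1)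
    (hw : C n * S * w = N - 1) (hN : euler k N = C n * N * w) :
    euler k w = N * w * I ^ 2 := by
  have hC : (C n : PowerSeries k) ≠ 0 := by rwa [Ne, map_eq_zero_iff _ C_injective]
  have hw' : C n * w = (N - 1) * I := by linear_combination I * hw - C n * w * hI
  have h1 := congrArg (euler k) hw'
  rw [euler_C_mul, euler_mul, map_sub, Derivation.map_one_eq_zero, hN,
    euler_of_mul_eq_one hn hS hI hN] at h1
  have hCt : C n = C (n - t) + C t := by rw [← map_add]; ring_nf
  apply mul_left_cancel₀ hC
  linear_combination h1 - N * w * I * C n * hI + N * w * I ^ 2 * hS - N * w * I ^ 2 * hCt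

/-- The terms of the polynomial in the formula for `Φ₁` which are powers of `N = ℓ ^ n`. The other
terms are `ℓ` times a multiple of `((n - t) N + t) ^ 3`. -/
def numerator (n t r : k) (N : PowerSeries k) : PowerSeries k :=
  C (t ^ 2 * n *
      (2 * t ^ 2 - 6 * t * n - 6 * t * r + 3 * n ^ 2 + 6 * n * r + n + 3 * r ^ 2 - 1)) * N +
  C (t * n * (n - t) *
      (4 * t ^ 2 - 5 * t * n - 12 * t * r - 2 * n ^ 2 + 6 * n * r + n + 6 * r ^ 2 - 2)) * N ^ 2 +
  C (n * (n - t) ^ 2 * (2 * t ^ 2 + t * n - 6 * t * r + 3 * r ^ 2 - 1)) * N ^ 3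

/-- The coefficient `h` in `Φ₁ / Φ₀ = (n - 1 - 2σ) / 24 + h ℓ⁻¹`; here `σ` stands for
`∑ 1 / d_k`. -/
def inverseCoeff (n t r σ : k) (N I : PowerSeries k) : PowerSeries k :=
  C ((24 * t * n ^ 3)⁻¹) * I ^ 3 * numerator n t r N -
    C ((3 * r ^ 2 - 2 * t * σ - 1) / (24 * t))

/-- The values in a field of `I = S⁻¹` and of the logarithmic derivative `w` of `ℓ`. -/
theorem inv_and_log_derivative_eq {K : Type*} [Field K] {n t N S I w : K} (hn : n ≠ 0)
    (hS : n * S = (n - t) * N + t) (hI : S * I = 1) (hw : n * S * w = N - 1) :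
    (n - t) * N + t ≠ 0 ∧ I = n / ((n - t) * N + t) ∧ w = (N - 1) / ((n - t) * N + t) := by
  have hS0 : S ≠ 0 := left_ne_zero_of_mul_eq_one hI
  have hy : (n - t) * N + t ≠ 0 := by rw [← hS]; exact mul_ne_zero hn hS0
  refine ⟨hy, ?_, ?_⟩
  · rw [eq_div_iff hy, ← hS]; linear_combination n * hI
  · rw [eq_div_iff hy, ← hS]; linear_combination hw

/-- The rational function identity behind `transport_leading`. -/
theorem leading_identity {K : Type*} [Field K] [CharZero K] {n t r x y w I : K}
    (hy0 : y ≠ 0) (hy : y = (n - t) * x + t) (hw : w = (x - 1) / y) (hI : I = n / y) :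
    y * ((r + 1) / 2 * w - (n - t) / 2 * x * w * I) + (n * (n - 1) / 2 * w * x -
      (x - 1) * (t * (t - 1) / 2 * w + (t + r) / 2)) = 0 := by
  rw [hw, hI]
  field_simp
  subst hy
  ring

/-- The rational function identity behind `transport_subleading`. Here `a` and `b` are the first and
second derivatives of the solution `G` of the first transport equation, divided by `G`. -/
theorem source_identity {K : Type*} [Field K] [CharZero K] {n t r σ x y w I a b h h' : K}
    (ht : t ≠ 0) (hn : n ≠ 0) (hy0 : y ≠ 0) (hy : y = (n - t) * x + t) (hw : w = (x - 1) / y)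
    (hI : I = n / y)
    (ha : a = (r + 1) / 2 * w - (n - t) / 2 * x * w * I)
    (hb : b = (r + 1) / 2 * (x * w * I ^ 2) - (n - t) / 2 * x * (n * w ^ 2 * I + x * w * I ^ 3 -
      (n - t) * x * w ^ 2 * I ^ 2) + a ^ 2)
    (c₁ c₂ c₃ : K)
    (h₁ : c₁ = t ^ 2 * n *
      (2 * t ^ 2 - 6 * t * n - 6 * t * r + 3 * n ^ 2 + 6 * n * r + n + 3 * r ^ 2 - 1))
    (h₂ : c₂ = t * n * (n - t) *
      (4 * t ^ 2 - 5 * t * n - 12 * t * r - 2 * n ^ 2 + 6 * n * r + n + 6 * r ^ 2 - 2))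
    (h₃ : c₃ = n * (n - t) ^ 2 * (2 * t ^ 2 + t * n - 6 * t * r + 3 * r ^ 2 - 1))
    (hh : h = (24 * t * n ^ 3)⁻¹ * I ^ 3 * (c₁ * x + c₂ * x ^ 2 + c₃ * x ^ 3) -
      (3 * r ^ 2 - 2 * t * σ - 1) / (24 * t))
    (hh' : h' = (24 * t * n ^ 3)⁻¹ * (I ^ 3 * (n * x * w) * (c₁ + 2 * c₂ * x + 3 * c₃ * x ^ 2) -
      3 * I ^ 4 * (n - t) * x * w * (c₁ * x + c₂ * x ^ 2 + c₃ * x ^ 3))) :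
    y * (h' - w * h) + (x * (n * (n - 1) / 2 * b + n * (n - 1) * (n - 2) / 2 * w * a +
      n * (n - 1) * (n - 2) / 6 * (x * w * I ^ 2 + w ^ 2) +
      n * (n - 1) * (n - 2) * (n - 3) / 8 * w ^ 2)
     - (x - 1) * (t * (t - 1) / 2 * b + t * (t - 1) * (t - 2) / 2 * w * a +
      t * (t - 1) * (t - 2) / 6 * (x * w * I ^ 2 + w ^ 2) +
      t * (t - 1) * (t - 2) * (t - 3) / 8 * w ^ 2 +
      (t + r) / 2 * ((t - 1) * a + (t - 1) * (t - 2) / 2 * w) +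
      (((t + r) / 2) ^ 2 - (2 * t + 3 * r + σ) / 6) / 2)) = 0 := by
  have e1 : a = (x - 1) * ((r + 1) * y - (n - t) * x * n) / (2 * y ^ 2) := by
    rw [ha, hw, hI]; field_simp
  have e2 : b = (x - 1) * (2 * n ^ 2 * (r + 1) * x * y - 2 * (n - t) * n * x *
      (n * (x - 1) * y + n ^ 2 * x - n * (n - t) * x * (x - 1)) +
      (x - 1) * ((r + 1) * y - (n - t) * x * n) ^ 2) / (4 * y ^ 4) := by
    rw [hb, e1, hw, hI]; field_simp; ring
  have e3 : h = ((c₁ * x + c₂ * x ^ 2 + c₃ * x ^ 3) - (3 * r ^ 2 - 2 * t * σ - 1) * y ^ 3) /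
      (24 * t * y ^ 3) := by
    rw [hh, hI]; field_simp
  have e4 : h' = n * x * (x - 1) * ((c₁ + 2 * c₂ * x + 3 * c₃ * x ^ 2) * y -
      3 * (n - t) * (c₁ * x + c₂ * x ^ 2 + c₃ * x ^ 3)) / (24 * t * y ^ 5) := by
    rw [hh', hw, hI]; field_simp
  rw [e1, e2, e3, e4, hw, hI]
  clear e1 e2 e3 e4 hw hI ha hb hh hh'
  field_simp
  subst h₁ h₂ h₃ hy
  ring

/-- A series `G` with the logarithmic derivative of `ℓ ^ ((r + 1) / 2) S ^ (-1 / 2)` solves the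
first transport equation. -/
theorem transport_leading [CharZero k] (hn : n ≠ 0) (hS : C n * S = C (n - t) * N + C t)
    (hI : S * I = 1) (hw : C n * S * w = N - 1)
    (hG : euler k G = (C ((r + 1) / 2) * w - C ((n - t) / 2) * N * w * I) * G) :
    transport n t ((t + r) / 2) N w G = 0 := by
  have key : (C (n - t) * N + C t) * (C ((r + 1) / 2) * w - C ((n - t) / 2) * N * w * I) +
      (C (n * (n - 1) / 2) * w * N - (N - 1) * (C (t * (t - 1) / 2) * w + C ((t + r) / 2))) =
      0 := by
    -- the identity is one of rational functions, and is checked in the field of fractions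
    let K := FractionRing (PowerSeries k)
    let e : PowerSeries k →+* K := algebraMap _ K
    have he : Function.Injective e := IsFractionRing.injective _ K
    let φ : k →+* K := e.comp C
    have hφ (c : k) : e (C c) = φ c := rfl
    have hn' : φ n ≠ 0 := by rwa [Ne, map_eq_zero_iff _ φ.injective]
    have hS' := congrArg e hS
    have hI' := congrArg e hI
    have hw' := congrArg e hw
    have : CharZero K := charZero_of_injective_ringHom φ.injective
    apply he
    simp only [map_add, map_mul, map_sub, hφ, map_one, map_div₀, map_ofNat, map_zero] at *
    obtain ⟨hy, hI2, hw2⟩ := inv_and_log_derivative_eq hn' hS' hI' hw'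
    exact leading_identity hy rfl hw2 hI2
  rw [transport, firstOp, firstOp, hG]
  rw [map_sub] at key
  simp only [map_zero]
  linear_combination G * key

theorem euler_inverseCoeff (hn : n ≠ 0) (hS : C n * S = C (n - t) * N + C t)
    (hI : S * I = 1) (hN : euler k N = C n * N * w) :
    euler k (inverseCoeff n t r σ N I) = C ((24 * t * n ^ 3)⁻¹) * (
      I ^ 3 * (C n * N * w) * (
        C (t ^ 2 * n *
          (2 * t ^ 2 - 6 * t * n - 6 * t * r + 3 * n ^ 2 + 6 * n * r + n + 3 * r ^ 2 - 1)) +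
        2 * C (t * n * (n - t) *
          (4 * t ^ 2 - 5 * t * n - 12 * t * r - 2 * n ^ 2 + 6 * n * r + n + 6 * r ^ 2 - 2)) * N +
        3 * C (n * (n - t) ^ 2 * (2 * t ^ 2 + t * n - 6 * t * r + 3 * r ^ 2 - 1)) * N ^ 2) -
      3 * I ^ 4 * C (n - t) * N * w * numerator n t r N) := by
  rw [inverseCoeff, map_sub, euler_C, mul_assoc, euler_C_mul, euler_mul, euler_pow,
    euler_of_mul_eq_one hn hS hI hN, numerator, map_add, map_add, euler_C_mul, euler_C_mul,
    euler_C_mul, euler_pow, euler_pow, hN]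
  push_cast
  ring

/-- `source_identity` for power series, with `I = S⁻¹`. -/
theorem source_identity_powerSeries [CharZero k] (hn : n ≠ 0) (ht : t ≠ 0)
    (hS : C n * S = C (n - t) * N + C t) (hI : S * I = 1) (hw : C n * S * w = N - 1)
    {a b h h' : PowerSeries k}
    (ha : a = C ((r + 1) / 2) * w - C ((n - t) / 2) * N * w * I)
    (hb : b = C ((r + 1) / 2) * (N * w * I ^ 2) - C ((n - t) / 2) * N * (C n * w ^ 2 * I +
        N * w * I ^ 3 - C (n - t) * N * w ^ 2 * I ^ 2) + a ^ 2)
    (hh : h = inverseCoeff n t r σ N I)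
    (hh' : h' = C ((24 * t * n ^ 3)⁻¹) * (
      I ^ 3 * (C n * N * w) * (
        C (t ^ 2 * n *
          (2 * t ^ 2 - 6 * t * n - 6 * t * r + 3 * n ^ 2 + 6 * n * r + n + 3 * r ^ 2 - 1)) +
        2 * C (t * n * (n - t) *
          (4 * t ^ 2 - 5 * t * n - 12 * t * r - 2 * n ^ 2 + 6 * n * r + n + 6 * r ^ 2 - 2)) * N +
        3 * C (n * (n - t) ^ 2 * (2 * t ^ 2 + t * n - 6 * t * r + 3 * r ^ 2 - 1)) * N ^ 2) -
      3 * I ^ 4 * C (n - t) * N * w * numerator n t r N)) :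
    (C (n - t) * N + C t) * (h' - w * h) +
      (N * (C (n * (n - 1) / 2) * b + C (n * (n - 1) * (n - 2) / 2) * w * a +
        C (n * (n - 1) * (n - 2) / 6) * (N * w * I ^ 2 + w ^ 2) +
        C (n * (n - 1) * (n - 2) * (n - 3) / 8) * w ^ 2) -
      (N - 1) * (C (t * (t - 1) / 2) * b + C (t * (t - 1) * (t - 2) / 2) * w * a +
        C (t * (t - 1) * (t - 2) / 6) * (N * w * I ^ 2 + w ^ 2) +
        C (t * (t - 1) * (t - 2) * (t - 3) / 8) * w ^ 2 +
        C ((t + r) / 2) * (C (t - 1) * a + C ((t - 1) * (t - 2) / 2) * w) +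
        C ((((t + r) / 2) ^ 2 - (2 * t + 3 * r + σ) / 6) / 2))) = 0 := by
  -- the identity is one of rational functions, and is checked in the field of fractions
  let K := FractionRing (PowerSeries k)
  let e : PowerSeries k →+* K := algebraMap _ K
  have he : Function.Injective e := IsFractionRing.injective _ K
  let φ : k →+* K := e.comp C
  have hφ (c : k) : e (C c) = φ c := rfl
  have hn' : φ n ≠ 0 := by rwa [Ne, map_eq_zero_iff _ φ.injective]
  have hS' := congrArg e hS
  have hI' := congrArg e hI
  have hw' := congrArg e hw
  have : CharZero K := charZero_of_injective_ringHom φ.injective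
  have ht' : φ t ≠ 0 := by rwa [Ne, map_eq_zero_iff _ φ.injective]
  replace ha := congrArg e ha
  replace hb := congrArg e hb
  replace hh := congrArg e hh
  replace hh' := congrArg e hh'
  apply he
  simp only [map_add, map_mul, map_sub, hφ, map_one, map_div₀, map_ofNat, map_zero, map_pow,
    map_inv₀, inverseCoeff, numerator] at *
  obtain ⟨hy, hI2, hw2⟩ := inv_and_log_derivative_eq hn' hS' hI' hw'
  exact source_identity ht' hn' hy rfl hw2 hI2 ha hb _ _ _ rfl rfl rfl hh hh'

/-- The closed formula for `Φ₁` solves the second transport equation, for `G = Φ₀` and `J = ℓ⁻¹`. -/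
theorem transport_subleading [CharZero k] (hn : n ≠ 0) (ht : t ≠ 0)
    (hS : C n * S = C (n - t) * N + C t)
    (hI : S * I = 1) (hw : C n * S * w = N - 1) (hN : euler k N = C n * N * w)
    (hJ : euler k J = -J * w)
    (hG : euler k G = (C ((r + 1) / 2) * w - C ((n - t) / 2) * N * w * I) * G) :
    transport n t ((t + r) / 2) N w
        (G * (C ((n - 1 - 2 * σ) / 24) + J * inverseCoeff n t r σ N I)) +
      J * source n t ((t + r) / 2) ((2 * t + 3 * r + σ) / 6) N w G = 0 := by
  have hdI := euler_of_mul_eq_one hn hS hI hN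
  have hdw := euler_log_derivative hn hS hI hw hN
  have hdh := euler_inverseCoeff (r := r) (σ := σ) hn hS hI hN
  have hlead := transport_leading hn hS hI hw hG
  have hG2 : euler k (euler k G) =
      (C ((r + 1) / 2) * (N * w * I ^ 2) - C ((n - t) / 2) * N * (C n * w ^ 2 * I +
        N * w * I ^ 3 - C (n - t) * N * w ^ 2 * I ^ 2) +
        (C ((r + 1) / 2) * w - C ((n - t) / 2) * N * w * I) ^ 2) * G := by
    rw [hG, euler_mul, hG, map_sub, euler_C_mul, mul_assoc (C ((n - t) / 2)), mul_assoc (C _),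
      euler_C_mul, euler_mul, euler_mul, hdI, hdw, hN]
    ring
  have key := source_identity_powerSeries (r := r) (σ := σ) hn ht hS hI hw rfl rfl rfl hdh
  rw [transport, firstOp, firstOp] at hlead
  rw [transport, source, firstOp, firstOp, secondOp, secondOp, hG2, euler_mul, map_add, euler_C,
    euler_mul J, hJ, hdw]
  -- as `G` solves the homogeneous equation, only the derivative of `J h` is left against the source
  generalize inverseCoeff n t r σ N I = h at *
  generalize euler k h = h' at *
  rw [hG] at hlead ⊢
  generalize C ((r + 1) / 2) * w - C ((n - t) / 2) * N * w * I = a at *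
  generalize C ((r + 1) / 2) * (N * w * I ^ 2) - C ((n - t) / 2) * N * (C n * w ^ 2 * I +
        N * w * I ^ 3 - C (n - t) * N * w ^ 2 * I ^ 2) = b at *
  simp only [map_sub C n t, map_zero, zero_pow, ne_eq, OfNat.ofNat_ne_zero, not_false_eq_true,
    sub_zero, zero_div, zero_mul] at key hlead ⊢
  linear_combination G * J * key + (C ((n - 1 - 2 * σ) / 24) + J * h) * hlead

end Transport

/-! ### The closed formulas -/

section ClosedFormulas

variable {r : ℕ} {d : Fin r → ℕ}

/-- The transport equations for the first two coefficients of `Q` in `z`. -/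
theorem transport_zCoeff {n : ℕ} {N w J ℓ : PowerSeries ℂ} {t : ℕ} {κ : ℂ}
    (hN : ℓ ^ n = N) (hℓ : N - 1 = C κ * X * ℓ ^ t) (hJ : ℓ * J = 1) (hw : euler ℂ ℓ = ℓ * w)
    {cs : List ℂ} (hcs : cs.length = t) {F : PowerSeries (PowerSeries ℂ)}
    (hF : shiftRem X (map C ℓ) ((List.replicate n 0).map C) F =
        map C (C κ * X) * shiftRem X (map C ℓ) (cs.map C) F) :
    transport (n : ℂ) t cs.sum N w (zCoeff 0 F) = 0 ∧
      transport (n : ℂ) t cs.sum N w (zCoeff 1 F) +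
        J * source (n : ℂ) t cs.sum (cs.map fun c => c ^ 2).sum N w (zCoeff 0 F) = 0 := by
  have h0 := congrArg (zCoeff 0) hF
  have h1 := congrArg (zCoeff 1) hF
  rw [zCoeff_map_C_mul, zCoeff_zero_shiftRem hJ hw, zCoeff_zero_shiftRem hJ hw] at h0
  rw [zCoeff_map_C_mul, zCoeff_one_shiftRem hJ hw, zCoeff_one_shiftRem hJ hw] at h1
  have hsum : ((List.replicate n (0 : ℂ)).map fun c => c ^ 2).sum = 0 := by simp
  rw [hsum] at h1
  rw [List.length_replicate, List.sum_replicate, smul_zero, hcs, hN] at h0 h1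
  rw [transport, transport, source]
  constructor
  · linear_combination ℓ * h0 - firstOp w t cs.sum (zCoeff 0 F) * ℓ * J * hℓ -
      (N * firstOp w n 0 (zCoeff 0 F) - (N - 1) * firstOp w t cs.sum (zCoeff 0 F)) * hJ
  · set A := N * firstOp w n 0 (zCoeff 1 F) - (N - 1) * firstOp w t cs.sum (zCoeff 1 F)
    set B := N * secondOp w n 0 0 (zCoeff 0 F) -
      (N - 1) * secondOp w t cs.sum (cs.map fun c => c ^ 2).sum (zCoeff 0 F)
    have h2 : J * (A + J * B) = 0 := by
      linear_combination h1 - (J * firstOp w t cs.sum (zCoeff 1 F) +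
        J ^ 2 * secondOp w t cs.sum (cs.map fun c => c ^ 2).sum (zCoeff 0 F)) * hℓ
    linear_combination ℓ * h2 - (A + J * B) * hJ

/-- The logarithmic derivative of a solution of `ℓ ^ n - 1 = κ q ℓ ^ t`. -/
theorem log_derivative_of_pow_sub_one_eq {n t : ℕ} {N J ℓ : PowerSeries ℂ} {κ : ℂ}
    (hN : ℓ ^ n = N) (hℓ : N - 1 = C κ * X * ℓ ^ t) (hJ : ℓ * J = 1) :
    (C ((n : ℂ) - t) * N + C (t : ℂ)) * (J * euler ℂ ℓ) = N - 1 := by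
  have hw : euler ℂ ℓ = ℓ * (J * euler ℂ ℓ) := by linear_combination -euler ℂ ℓ * hJ
  have h := congrArg (euler ℂ) hℓ
  have hX : euler ℂ X = X := by
    rw [euler_apply, derivative_X, mul_one]
  rw [← hN, map_sub, euler_pow_of_log hw, Derivation.map_one_eq_zero, mul_assoc (C κ) X,
    euler_C_mul, euler_mul, euler_pow_of_log hw, hX, hN] at h
  rw [map_sub]
  linear_combination h - (1 + C (t : ℂ) * (J * euler ℂ ℓ)) * hℓ

theorem constantCoeff_inverseCoeff {k : Type*} [Field k] [CharZero k] {n t r σ : k}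
    {N I : PowerSeries k} (hn : n ≠ 0) (ht : t ≠ 0) (hN : constantCoeff N = 1)
    (hI : constantCoeff I = 1) :
    constantCoeff (inverseCoeff n t r σ N I) = -((n - 1 - 2 * σ) / 24) := by
  simp only [inverseCoeff, numerator, map_sub, map_add, map_mul, map_pow, hN, hI,
    constantCoeff_C]
  field_simp
  ring

/-- The polynomial in the formula for `Φ₁` in terms of `N = ℓ ^ n` and `n S = (n - t) N + t`. -/
theorem phiOnePoly_eq {n r t : ℕ} {ℓ S : PowerSeries ℂ}
    (hS : C (n : ℂ) * S = C ((n : ℂ) - t) * ℓ ^ n + C (t : ℂ)) :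
    phiOnePoly n r t ℓ =
      C ((t : ℂ) * n - t - 3 * r ^ 2 + 1) * C ((n : ℂ) ^ 3) * S ^ 3 * ℓ +
        numerator (n : ℂ) t r (ℓ ^ n) := by
  have h3 : C ((n : ℂ) ^ 3) * S ^ 3 = (C ((n : ℂ) - t) * ℓ ^ n + C (t : ℂ)) ^ 3 := by
    rw [← hS, map_pow]; ring
  rw [mul_assoc (C _) (C _) (S ^ 3), h3, phiOnePoly, numerator]
  simp only [smul_eq_C_mul, map_mul (C : ℂ →+* PowerSeries ℂ) (_ * (_ : ℂ)) (_ : ℂ),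
    map_mul (C : ℂ →+* PowerSeries ℂ), map_pow]
  simp only [map_ofNat]
  ring

end ClosedFormulas

end FanoHypergeometric

open FanoHypergeometric PowerSeries in
theorem mainTheorem6 (n r : ℕ) (hr : 1 ≤ r) (d : Fin r → ℕ) (hd : ∀ k, 1 ≤ d k)
    (hFano : FanoHypergeometric.totalDegree d < n) :
    FanoHypergeometric.HolomorphicAtZero (FanoHypergeometric.Q n d) ∧
    FanoHypergeometric.Phi n d 0 =
      FanoHypergeometric.ratPow (FanoHypergeometric.L n d) (((r : ℚ) + 1) / 2) *
        FanoHypergeometric.ratPow (FanoHypergeometric.S n d) (-1 / 2) ∧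
    FanoHypergeometric.Phi n d 1 =
      ((3 * (r : ℂ) ^ 2 - 2 * (FanoHypergeometric.totalDegree d : ℂ) * (∑ k, 1 / (d k : ℂ)) - 1) /
          (24 * (FanoHypergeometric.totalDegree d : ℂ))) •
        (FanoHypergeometric.ratPow (FanoHypergeometric.L n d) (((r : ℚ) - 1) / 2) *
          (FanoHypergeometric.L n d - 1) *
          FanoHypergeometric.ratPow (FanoHypergeometric.S n d) (-1 / 2)) +
      (1 / (24 * (FanoHypergeometric.totalDegree d : ℂ) * (n : ℂ) ^ 3)) •
        (FanoHypergeometric.ratPow (FanoHypergeometric.L n d) (((r : ℚ) - 1) / 2) *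
          FanoHypergeometric.ratPow (FanoHypergeometric.S n d) (-7 / 2) *
          FanoHypergeometric.phiOnePoly n r (FanoHypergeometric.totalDegree d)
            (FanoHypergeometric.L n d)) := by
  have hn0 : n ≠ 0 := by omega
  have hn : (n : ℂ) ≠ 0 := by exact_mod_cast hn0
  have ht : (totalDegree d : ℂ) ≠ 0 := by
    have : 1 ≤ totalDegree d :=
      (hd ⟨0, hr⟩).trans (Finset.single_le_sum (f := d) (fun _ _ => Nat.zero_le _)
        (Finset.mem_univ _))
    exact_mod_cast Nat.one_le_iff_ne_zero.mp this
  obtain ⟨hL1, hLeq, F, hFQ, hF1, hF⟩ := exists_regular_factor hn0 hd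
  rw [Phi_zero_eq hFQ, Phi_one_eq hFQ]
  refine ⟨holomorphicAtZero_of_map hFQ, ?_⟩
  set ℓ := L n d with hℓdef
  set t := totalDegree d with htdef
  set σ : ℂ := ∑ k, 1 / (d k : ℂ) with hσ
  have hS : C (n : ℂ) * S n d = C ((n : ℂ) - t) * ℓ ^ n + C (t : ℂ) := by
    have hc : C (n : ℂ) * C ((selfPower d : ℂ) * (1 - (t : ℂ) / n)) =
        (C ((n : ℂ) - t) * C (selfPower d : ℂ) : PowerSeries ℂ) := by
      rw [← map_mul, ← map_mul]; congr 1; field_simp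
    rw [S, smul_eq_C_mul, ← htdef, ← hℓdef]
    have hC : C (n : ℂ) = (C ((n : ℂ) - t) + C (t : ℂ) : PowerSeries ℂ) := by
      rw [← map_add]; congr 1; ring
    linear_combination X * ℓ ^ t * hc + hC - C ((n : ℂ) - t) * hLeq
  have hS1 : constantCoeff (S n d) = 1 := by
    rw [S, smul_eq_C_mul]; simp
  set s := S n d with hsdef
  obtain ⟨J, hJ⟩ : ∃ J, ℓ * J = 1 := ⟨ℓ⁻¹, PowerSeries.mul_inv_cancel _ (by simp [hL1])⟩
  obtain ⟨I, hI⟩ : ∃ I, s * I = 1 := ⟨s⁻¹, PowerSeries.mul_inv_cancel _ (by simp [hS1])⟩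
  have hJ1 : constantCoeff J = 1 := by simpa [hL1] using congrArg constantCoeff hJ
  have hI1 : constantCoeff I = 1 := by simpa [hS1] using congrArg constantCoeff hI
  obtain ⟨w, hwdef⟩ : ∃ w, w = J * euler ℂ ℓ := ⟨_, rfl⟩
  have hwℓ : euler ℂ ℓ = ℓ * w := by rw [hwdef]; linear_combination -euler ℂ ℓ * hJ
  have hw0 : constantCoeff w = 0 := by rw [hwdef]; simp
  obtain ⟨N, hN⟩ : ∃ N, ℓ ^ n = N := ⟨_, rfl⟩
  rw [hN] at hS hLeq
  have hN1 : constantCoeff N = 1 := by rw [← hN]; simp [hL1]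
  have hw : C (n : ℂ) * s * w = N - 1 := by
    rw [hS, hwdef]; exact log_derivative_of_pow_sub_one_eq hN hLeq hJ
  have hdN : euler ℂ N = C (n : ℂ) * N * w := by rw [← hN]; exact euler_pow_of_log hwℓ n
  obtain ⟨h0, h1⟩ := transport_zCoeff hN hLeq hJ hwℓ (length_factors d) hF
  rw [sum_factors hd] at h0 h1
  rw [sum_sq_factors hd, ← hσ] at h1
  have hF0 : constantCoeff (zCoeff 0 F) = 1 := by
    rw [← coeff_zero_eq_constantCoeff_apply, zCoeff, coeff_mk, coeff_zero_eq_constantCoeff_apply F,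
      hF1]
    simp
  have hF10 : constantCoeff (zCoeff 1 F) = 0 := by
    rw [← coeff_zero_eq_constantCoeff_apply, zCoeff, coeff_mk, coeff_zero_eq_constantCoeff_apply F,
      hF1, coeff_one]
    simp
  obtain ⟨G, hGdef⟩ : ∃ G, ratPow ℓ (((r : ℚ) + 1) / 2) * ratPow s (-1 / 2) = G := ⟨_, rfl⟩
  have hG1 : constantCoeff G = 1 := by
    rw [← hGdef, map_mul, constantCoeff_ratPow hL1, constantCoeff_ratPow hS1, mul_one]
  have hds : euler ℂ s = C ((n : ℂ) - t) * N * w := by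
    have hC : (C (n : ℂ) : PowerSeries ℂ) ≠ 0 := by rwa [Ne, map_eq_zero_iff _ C_injective]
    have h2 := congrArg (euler ℂ) hS
    rw [euler_C_mul, map_add, euler_C_mul, euler_C, hdN] at h2
    apply mul_left_cancel₀ hC
    linear_combination h2
  have hG : euler ℂ G =
      (C (((r : ℂ) + 1) / 2) * w - C (((n : ℂ) - t) / 2) * N * w * I) * G := by
    have hA := mul_euler_ratPow hL1 (((r : ℚ) + 1) / 2)
    have hB := mul_euler_ratPow hS1 (-1 / 2)
    rw [hwℓ] at hA
    rw [hds] at hB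
    have hc1 : (((((r : ℚ) + 1) / 2 : ℚ)) : ℂ) = ((r : ℂ) + 1) / 2 := by push_cast; rfl
    have hc2 : C ((((-1 : ℚ) / 2 : ℚ)) : ℂ) * C ((n : ℂ) - t) =
        (-C (((n : ℂ) - t) / 2) : PowerSeries ℂ) := by
      rw [← map_mul, ← map_neg]; congr 1; push_cast; ring
    rw [hc1] at hA
    rw [← hGdef, euler_mul]
    generalize ratPow ℓ (((r : ℚ) + 1) / 2) = U at *
    generalize ratPow s (-1 / 2) = V at *
    linear_combination J * V * hA + I * U * hB + N * w * I * U * V * hc2 -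
      (V * euler ℂ U - C (((r : ℂ) + 1) / 2) * w * U * V) * hJ - U * euler ℂ V * hI
  -- both closed formulas solve the transport equations with the right constant term
  have hΦ0 : zCoeff 0 F = G :=
    eq_of_transport_eq hn hS hI hN1 hw0 (h0.trans (transport_leading hn hS hI hw hG).symm)
      (hF0.trans hG1.symm)
  have hΦ1 : zCoeff 1 F =
      G * (C (((n : ℂ) - 1 - 2 * σ) / 24) + J * inverseCoeff (n : ℂ) t r σ N I) := by
    refine eq_of_transport_eq hn hS hI hN1 hw0 (s := ((t : ℂ) + r) / 2) ?_ ?_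
    · have h2 := transport_subleading (σ := σ) hn ht hS hI hw hdN (euler_inv_of_log hJ hwℓ) hG
      rw [hΦ0] at h1
      exact add_right_cancel (h1.trans h2.symm)
    · rw [hF10, map_mul, hG1, map_add, map_mul, hJ1, constantCoeff_inverseCoeff hn ht hN1 hI1,
        constantCoeff_C]
      ring
  refine ⟨hΦ0.trans hGdef.symm, ?_⟩
  rw [hΦ1, ← hGdef, phiOnePoly_eq (S := s) (by rw [hN]; exact hS), hN, smul_eq_C_mul,
    smul_eq_C_mul, inverseCoeff,
    ← ratPow_mul_pow hL1 (((r : ℚ) - 1) / 2) (((r : ℚ) + 1) / 2) 1 (by push_cast; ring),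
    ← ratPow_mul_pow hS1 (-7 / 2) (-1 / 2) 3 (by norm_num)]
  generalize ratPow ℓ (((r : ℚ) - 1) / 2) = U
  generalize ratPow s (-7 / 2) = V
  generalize numerator (n : ℂ) t r N = p
  have hI3 : s ^ 3 * I ^ 3 = 1 := by rw [← mul_pow, hI, one_pow]
  have e1 : (24 * (t : ℂ) * (n : ℂ) ^ 3)⁻¹ = 1 / (24 * (t : ℂ) * (n : ℂ) ^ 3) := (one_div _).symm
  -- the terms of `phiOnePoly` divisible by `ℓ` supply the difference between the two constants
  have e2 : C (((n : ℂ) - 1 - 2 * σ) / 24) =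
      C ((3 * (r : ℂ) ^ 2 - 2 * t * σ - 1) / (24 * t)) + C (1 / (24 * (t : ℂ) * (n : ℂ) ^ 3)) *
        (C ((t : ℂ) * n - t - 3 * r ^ 2 + 1) * C ((n : ℂ) ^ 3)) := by
    rw [← map_mul, ← map_mul, ← map_add]
    congr 1
    field_simp
    ring
  rw [e1, e2]
  generalize C (1 / (24 * (t : ℂ) * (n : ℂ) ^ 3)) = τ
  generalize C ((3 * (r : ℂ) ^ 2 - 2 * t * σ - 1) / (24 * t)) = α
  linear_combination U * V * (s ^ 3 * (τ * I ^ 3 * p - α) * hJ + τ * p * hI3)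

end
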